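/- **Setting.** Let $I$ be a finite set of $n\ge 2$ agents. Agent $i$ has a finite nonempty set $A_i$ of actions and a deterministic utility $U_i:\prod_j A_j\to[0,1]$. The game is assumed *interdependent*: for every action profile $\mathbf a$ and every $\emptyset\subsetneq J\subsetneq I$ there are $i\notin J$ and actions $a'_J$ with $U_i(a'_J,a_{-J})\ne U_i(\mathbf a)$. Let $c_F\in(0,1)$, let $F$ be a non-increasing function on $[0,1]$, and let $G(\bar u,u)$, defined for $0\le\bar u<u\le1$, be non-decreasing in $\bar u$ and non-increasing in $u$. Assume that there are constants $F_0,G_0$ with $F_0+G_0\le1$ such that $0\le F(u)\le F_0/n$ and $0\le G(\bar u,u)<G_0$ for all utilities $u$ and $\bar u<u$ in $[0,1]$. **The ITEL process.** The state of agent $i$ is either *discontent* or a triple $(m,\bar a,\bar u)$ with mood $m\in\{\text{content},\text{hopeful},\text{watchful}\}$, benchmark action $\bar a\in A_i$ and benchmark utility $\bar u$ in the range of $U_i$. A state of the process consists of one such state for each agent; let $\mathcal X$ be the set of states. For $\epsilon\in(0,1)$, $P^\epsilon$ is the following Markov chain on $\mathcal X$. First, independently, every agent chooses an action $a$: a discontent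 agent uniformly in $A_i$; a content agent with $\bar u<1$ plays $\bar a$ with probability $1-\epsilon$ and otherwise a uniformly chosen $a\ne\bar a$; any other agent plays $\bar a$. Each agent then observes its utility $u$ at the resulting action profile and, independently, updates its state, where *accept* means moving to $(\text{content},a,u)$, *revert* moving to $(\text{content},\bar a,\bar u)$, *reject* becoming discontent, and becoming hopeful or watchful keeps $(\bar a,\bar u)$: - discontent: accept with probability $\min(\epsilon^{F(u)},c_F)$, else reject; - content, $a\ne\bar a$: if $u>\bar u$, accept with probability $\epsilon^{G(\bar u,u)}$, else revert; if $u\le\bar u$, revert; - content, $a=\bar a$: become hopeful if $u>\bar u$, revert if $u=\bar u$, become watchful if $u<\bar u$; - hopeful: accept if $u>\bar u$, revert if $u=\bar u$, become watchful if $u<\bar u$; - watchful: become hopeful if $u>\bar u$, revert if $u=\bar u$, reject if $u<\bar u$. **Potential.** The resistance $r(x\to y)$ is the number $r\ge0$ with $0<\lim_{\epsilon\to0^+}\epsilon^{-r}P^\epsilon_{x,y}<\infty$, or $+\infty$ if $P^\epsilon_{x,y}=0$. The resistance graph has vertex set $\mathcal X$ and an edge $x\to y$ of weight $r(x\to y)$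 whenever this is finite. An $x$-tree is an acyclic subgraph in which every vertex $y\neq x$ has exactly one outgoing edge and $x$ has none. The potential $\gamma(x)$ is the minimum over all $x$-trees of the sum of the resistances of the edges ($+\infty$ if there is no $x$-tree), and $\mathcal X^\star=\{x\in\mathcal X:\gamma(x)=\min_{\mathcal X}\gamma\}$. **States of interest.** A state is *aligned* if all agents are content and $\bar u_i=U_i(\bar{\mathbf a})$ for all $i$, where $\bar{\mathbf a}$ is the benchmark action profile; $\mathcal C$ is the set of aligned states. $\mathcal E\subset\mathcal C$ is the set of those for which $\bar{\mathbf a}$ is a Nash equilibrium, that is, $U_i(a_i,\bar a_{-i})\le U_i(\bar{\mathbf a})$ for all $i$ and all $a_i\ne\bar a_i$, and $\mathcal A\subset\mathcal E$ is the set of those with $\bar u_i=1$ for all $i$ (optimal states). For $x\in\mathcal C$ put $\widetilde W(x)=1-\sum_iF(\bar u_i)$, and for $x\in\mathcal C\setminus\mathcal E$ put $$\widetilde S(x)=1-\min\{G(\bar u_i,U_i(a_i,\bar a_{-i})) : i\in I,\ a_i\ne\bar a_i,\ U_i(a_i,\bar a_{-i})>\bar u_i\}.$$ **Theorem.** Assume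 that $\mathcal A=\emptyset$. If $\mathcal E\ne\emptyset$, then $\mathcal X^\star=\arg\max_{x\in\mathcal E}\widetilde W(x)$. If $\mathcal E=\emptyset$, then $\mathcal X^\star=\arg\max_{x\in\mathcal C}\bigl(\widetilde W(x)-\widetilde S(x)\bigr)$. -/

import Mathlib

open Filter Topology
open scoped ENNReal NNReal

namespace ITEL

/-! ### Resistances, rooted trees and potentials of a perturbed Markov process -/

section Perturbed

/-- `f ε` behaves like `ε ^ r` as `ε → 0⁺`, i.e. `0 < lim ε ^ (-r) * f ε < ∞`. -/
def HasResistance (f : ℝ → ℝ) (r : ℝ≥0) : Prop :=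
  ∃ L : ℝ, 0 < L ∧ Tendsto (fun ε : ℝ => ε ^ (-(r : ℝ)) * f ε) (𝓝[>] 0) (𝓝 L)

/-- The resistance of a family of non-negative numbers: the unique `r ≥ 0` with
`HasResistance f r`, and `∞` when there is none, in particular when `f = 0`. -/
noncomputable def resistance (f : ℝ → ℝ) : ℝ≥0∞ :=
  ⨅ (r : ℝ≥0) (_ : HasResistance f r), (r : ℝ≥0∞)

variable {X : Type*}

/-- `T` is (the edge set of) an `x`-tree of the directed graph whose edges are the pairs of finite
weight `w`: an acyclic subgraph in which every vertex other than `x` has exactly one outgoing edge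
and `x` has none. -/
structure IsRootedTree (w : X → X → ℝ≥0∞) (x : X) (T : Finset (X × X)) : Prop where
  edge : ∀ e ∈ T, w e.1 e.2 ≠ ∞
  out : ∀ y, y ≠ x → ∃! z, (y, z) ∈ T
  root : ∀ z, (x, z) ∉ T
  acyclic : ∀ y, ¬ Relation.TransGen (fun a b => (a, b) ∈ T) y y

/-- The potential of `x`: the least total weight of an `x`-tree (`∞` if there is no `x`-tree). -/
noncomputable def potential (w : X → X → ℝ≥0∞) (x : X) : ℝ≥0∞ :=
  ⨅ (T : Finset (X × X)) (_ : IsRootedTree w x T), ∑ e ∈ T, w e.1 e.2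

/-- The vertices of minimum potential. -/
def minPotential (w : X → X → ℝ≥0∞) : Set X :=
  {x | ∀ y, potential w x ≤ potential w y}

end Perturbed

/-! ### States -/

/-- The moods of an agent that is not discontent. -/
inductive Mood
  | content
  | hopeful
  | watchful

/-- State of an agent with action set `A` and set of possible utilities `V`. The behaviour of a
discontent agent does not depend on its benchmark, so a discontent agent keeps none. -/
inductive AgentState (A V : Type*)
  | discontent
  | bench (m : Mood) (a : A) (u : V)

section Game

variable {I : Type*} {A : I → Type*}

/-- The set of utilities that agent `i` may observe. -/
abbrev Util (U : I → (∀ j, A j) → ℝ) (i : I) : Type := Set.range (U i)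

/-- The utility observed by agent `i` when the action profile `a` is played. -/
def observe (U : I → (∀ j, A j) → ℝ) (i : I) (a : ∀ j, A j) : Util U i := ⟨U i a, a, rfl⟩

/-- The states of the process: one agent state for each agent. -/
abbrev State (U : I → (∀ j, A j) → ℝ) : Type _ := ∀ i, AgentState (A i) (Util U i)

/-! ### The policies -/

/-- Action policy: the probability that an agent in the given state plays `a`. A discontent agent
plays uniformly; a content agent with benchmark utility below `1` explores with probability `ε`,
uniformly among the actions other than its benchmark; every other agent plays its benchmark. -/
noncomputable def actionProb {B : Type*} [Fintype B] {V : Set ℝ} (ε : ℝ) :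
    AgentState B V → B → ℝ
  | .discontent, _ => 1 / (Fintype.card B : ℝ)
  | .bench .content b v, a =>
      open Classical in
      if (v : ℝ) < 1 then
        if a = b then 1 - ε else ε / ((Fintype.card B : ℝ) - 1)
      else
        if a = b then 1 else 0
  | .bench _ b _, a => open Classical in if a = b then 1 else 0

/-- Probability of `y` for the point mass at `s`. -/
noncomputable def pointMass {S : Type*} (s y : S) : ℝ :=
  open Classical in if y = s then 1 else 0

/-- Probability of `y` when `s` is chosen with probability `p`, and `t` otherwise. -/
noncomputable def choice {S : Type*} (p : ℝ) (s t y : S) : ℝ :=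
  p * pointMass s y + (1 - p) * pointMass t y

/-- Update policy: the probability that an agent in the given state that has played `a` and
observed `u` moves to the state `y`. Accepting leads to `bench content a u`, reverting to
`bench content b v`, rejecting to `discontent`. -/
noncomputable def updateProb {B : Type*} {V : Set ℝ} (F : ℝ → ℝ) (G : ℝ → ℝ → ℝ) (cF ε : ℝ) :
    AgentState B V → B → V → AgentState B V → ℝ
  | .discontent, a, u, y =>
      choice (min (ε ^ F u) cF) (.bench .content a u) .discontent y
  | .bench .content b v, a, u, y =>
      open Classical in
      if a = b then
        if (v : ℝ) < u then pointMass (.bench .hopeful b v) y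
        else if (u : ℝ) < v then pointMass (.bench .watchful b v) y
        else pointMass (.bench .content b v) y
      else
        if (v : ℝ) < u then choice (ε ^ G v u) (.bench .content a u) (.bench .content b v) y
        else pointMass (.bench .content b v) y
  | .bench .hopeful b v, a, u, y =>
      open Classical in
      if (v : ℝ) < u then pointMass (.bench .content a u) y
      else if (u : ℝ) < v then pointMass (.bench .watchful b v) y
      else pointMass (.bench .content b v) y
  | .bench .watchful b v, _, u, y =>
      open Classical in
      if (v : ℝ) < u then pointMass (.bench .hopeful b v) y
      else if (u : ℝ) < v then pointMass .discontent y
      else pointMass (.bench .content b v) y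

/-- The transition probability from `x` to `y`: the agents independently choose their actions,
observe their utilities at the resulting action profile, and independently update their states. -/
noncomputable def transition [Fintype I] [DecidableEq I] [∀ i, Fintype (A i)]
    (U : I → (∀ j, A j) → ℝ) (F : ℝ → ℝ) (G : ℝ → ℝ → ℝ) (cF ε : ℝ) (x y : State U) : ℝ :=
  ∑ a : ∀ i, A i, (∏ i, actionProb ε (x i) (a i)) *
    ∏ i, updateProb F G cF ε (x i) (a i) (observe U i a) (y i)

/-- The weights `r(x → y)` of the resistance graph. -/
noncomputable def edgeResistance [Fintype I] [DecidableEq I] [∀ i, Fintype (A i)]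
    (U : I → (∀ j, A j) → ℝ) (F : ℝ → ℝ) (G : ℝ → ℝ → ℝ) (cF : ℝ) (x y : State U) : ℝ≥0∞ :=
  resistance fun ε => transition U F G cF ε x y

/-! ### Assumptions -/

/-- For every action profile and every nonempty proper set `J` of agents, the agents of `J` can
change their actions so as to change the utility of some agent outside of `J`. -/
def Interdependent [Fintype I] [DecidableEq I] (U : I → (∀ j, A j) → ℝ) : Prop :=
  ∀ (a : ∀ j, A j) (J : Finset I), J.Nonempty → J ≠ Finset.univ →
    ∃ i, i ∉ J ∧ ∃ a' : ∀ j, A j, U i (J.piecewise a' a) ≠ U i a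

/-- Bounds on the resistance functions for `n` agents. -/
def ResistanceBounds (n : ℕ) (F : ℝ → ℝ) (G : ℝ → ℝ → ℝ) : Prop :=
  ∃ F₀ G₀ : ℝ,
    (∀ u ∈ Set.Icc (0 : ℝ) 1, 0 ≤ F u ∧ F u ≤ F₀ / n) ∧
    (∀ v ∈ Set.Icc (0 : ℝ) 1, ∀ u ∈ Set.Icc (0 : ℝ) 1, v < u → 0 ≤ G v u ∧ G v u < G₀) ∧
    F₀ + G₀ ≤ 1

/-! ### Aligned, equilibrium and optimal states -/

/-- `a` is a Nash equilibrium. -/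
def IsNash [DecidableEq I] (U : I → (∀ j, A j) → ℝ) (a : ∀ j, A j) : Prop :=
  ∀ i, ∀ b : A i, b ≠ a i → U i (Function.update a i b) ≤ U i a

/-- All agents are content in `x`, with benchmark action profile `a` and with the utilities
resulting from `a` as benchmark utilities. -/
def IsAlignedAt (U : I → (∀ j, A j) → ℝ) (x : State U) (a : ∀ j, A j) : Prop :=
  ∀ i, x i = .bench .content (a i) (observe U i a)

/-- The aligned states. -/
def alignedStates (U : I → (∀ j, A j) → ℝ) : Set (State U) :=
  {x | ∃ a, IsAlignedAt U x a}

/-- The aligned states whose benchmark action profile is an equilibrium. -/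
def equilibriumStates [DecidableEq I] (U : I → (∀ j, A j) → ℝ) : Set (State U) :=
  {x | ∃ a, IsAlignedAt U x a ∧ IsNash U a}

/-- The aligned states in which every agent has benchmark utility `1`. -/
def optimalStates (U : I → (∀ j, A j) → ℝ) : Set (State U) :=
  {x | ∃ a, IsAlignedAt U x a ∧ ∀ i, U i a = 1}

/-! ### Virtual welfare and stability -/

/-- The benchmark utility of an agent (meaningless, and set to `0`, for a discontent agent). -/
def AgentState.utility {B : Type*} {V : Set ℝ} : AgentState B V → ℝ
  | .discontent => 0
  | .bench _ _ u => u

/-- The virtual welfare, meant for aligned states. -/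
noncomputable def virtualWelfare [Fintype I] (U : I → (∀ j, A j) → ℝ) (F : ℝ → ℝ)
    (x : State U) : ℝ :=
  1 - ∑ i, F (x i).utility

/-- The virtual stability, meant for aligned states that are not equilibria: for those the
infimum is a minimum over a nonempty finite set. -/
noncomputable def virtualStability [DecidableEq I] (U : I → (∀ j, A j) → ℝ) (G : ℝ → ℝ → ℝ)
    (x : State U) : ℝ :=
  1 - sInf {g : ℝ | ∃ a, IsAlignedAt U x a ∧ ∃ i, ∃ b : A i, b ≠ a i ∧
    (x i).utility < U i (Function.update a i b) ∧
    g = G (x i).utility (U i (Function.update a i b))}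

end Game

end ITEL

/-! Resistances obey min-plus arithmetic: products add them and sums take their minimum. Hence the
resistance of a transition is the least cost of an action profile realising it
(`edgeResistance_eq`), and what remains is a problem about minimum-weight trees.

With `exitCost` abbreviated to E, the heart of the proof is an exact formula for the potential of
the aligned state at a: it is the sum of E(b) over all profiles b, minus E(a), plus the sum of
F(U_i(a)). Leaving an aligned state costs 2 at an equilibrium, where one agent must explore twice in
a row, and 1 plus the least G-value of a better reply elsewhere. From general discontent, the state
at a is reached by letting everybody accept, and by interdependence discontent spreads for free.

The upper bound (`potential_aligned_add_le`) gives each state a budget and follows affordable edges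
to the root. The lower bound (`le_potential_aligned_add`) is a duality argument: functions on states
that drop along an edge by no more than its weight force every tree to pay E(b) on edges leaving
`near U b`, and the acceptance cost on edges leaving the other states. These sets of edges are
disjoint, so the bounds add up. A root that is not aligned saves at most E(a) - 1 for some a and is
strictly beaten, because the acceptance cost of a is below 1 (`le_potential_add_of_not_aligned`).

So the minimisers are the aligned states maximising E(a) minus the sum of F(U_i(a)), which is
`score`. The bound F₀ + G₀ ≤ 1 places every equilibrium strictly above every other profile. -/

namespace ITEL

/-! ### Calculus of resistances -/

section Cost

/-- `f` is eventually zero and `c = ∞`, or `f` has the finite resistance `c`. -/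
def HasCost (f : ℝ → ℝ) (c : ℝ≥0∞) : Prop :=
  (c = ∞ ∧ f =ᶠ[𝓝[>] 0] fun _ => 0) ∨ ∃ r : ℝ≥0, c = r ∧ HasResistance f r

theorem tendsto_rpow_zero_of_pos {p : ℝ} (hp : 0 < p) :
    Tendsto (fun ε : ℝ => ε ^ p) (𝓝[>] 0) (𝓝 0) := by
  have h := (Real.continuousAt_rpow_const 0 p (Or.inr hp.le)).tendsto
  rw [Real.zero_rpow hp.ne'] at h
  exact h.mono_left nhdsWithin_le_nhds

theorem HasResistance.tendsto_zero {f : ℝ → ℝ} {r s : ℝ≥0} (h : HasResistance f s) (hrs : r < s) :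
    Tendsto (fun ε : ℝ => ε ^ (-(r : ℝ)) * f ε) (𝓝[>] 0) (𝓝 0) := by
  obtain ⟨L, -, hL⟩ := h
  have hp : (0 : ℝ) < (s : ℝ) - r := sub_pos.2 (by exact_mod_cast hrs)
  have := (tendsto_rpow_zero_of_pos hp).mul hL
  rw [zero_mul] at this
  refine this.congr' ?_
  filter_upwards [self_mem_nhdsWithin] with ε hε
  rw [← mul_assoc, ← Real.rpow_add hε]
  congr 2
  ring

theorem HasResistance.unique {f : ℝ → ℝ} {r s : ℝ≥0} (hr : HasResistance f r)
    (hs : HasResistance f s) : r = s := by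
  rcases lt_trichotomy r s with h | h | h
  · obtain ⟨L, hL, hL'⟩ := hr
    exact absurd (tendsto_nhds_unique hL' (hs.tendsto_zero h)) hL.ne'
  · exact h
  · obtain ⟨L, hL, hL'⟩ := hs
    exact absurd (tendsto_nhds_unique hL' (hr.tendsto_zero h)) hL.ne'

theorem HasCost.resistance_eq {f : ℝ → ℝ} {c : ℝ≥0∞} (h : HasCost f c) : resistance f = c := by
  rcases h with ⟨rfl, h⟩ | ⟨r, rfl, h⟩
  · refine iInf_eq_top.2 fun r => iInf_eq_top.2 fun ⟨L, hL, hL'⟩ => ?_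
    have : Tendsto (fun ε : ℝ => ε ^ (-(r : ℝ)) * f ε) (𝓝[>] 0) (𝓝 0) := by
      refine tendsto_const_nhds.congr' ?_
      filter_upwards [h] with ε hε
      rw [hε, mul_zero]
    exact absurd (tendsto_nhds_unique hL' this) hL.ne'
  · refine le_antisymm (iInf₂_le r h) (le_iInf₂ fun s hs => ?_)
    rw [h.unique hs]

theorem HasCost.zero : HasCost (fun _ => 0) ∞ := Or.inl ⟨rfl, EventuallyEq.rfl⟩

theorem HasCost.of_tendsto {f : ℝ → ℝ} {L : ℝ} (hL : 0 < L) (h : Tendsto f (𝓝[>] 0) (𝓝 L)) :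
    HasCost f 0 := by
  refine Or.inr ⟨0, by simp, L, hL, ?_⟩
  simpa using h

theorem HasCost.const {L : ℝ} (hL : 0 < L) : HasCost (fun _ => L) 0 :=
  .of_tendsto hL tendsto_const_nhds

theorem HasCost.congr {f g : ℝ → ℝ} {c : ℝ≥0∞} (h : HasCost f c) (hfg : f =ᶠ[𝓝[>] 0] g) :
    HasCost g c := by
  rcases h with ⟨rfl, h⟩ | ⟨r, rfl, L, hL, h⟩
  · exact Or.inl ⟨rfl, hfg.symm.trans h⟩
  · refine Or.inr ⟨r, rfl, L, hL, h.congr' ?_⟩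
    filter_upwards [hfg] with ε hε
    rw [hε]

theorem HasCost.rpow {p : ℝ} (hp : 0 ≤ p) : HasCost (fun ε => ε ^ p) (ENNReal.ofReal p) := by
  refine Or.inr ⟨p.toNNReal, rfl, 1, one_pos, tendsto_const_nhds.congr' ?_⟩
  filter_upwards [self_mem_nhdsWithin] with ε hε
  rw [Real.coe_toNNReal p hp, ← Real.rpow_add hε, neg_add_cancel, Real.rpow_zero]

theorem HasCost.mul {f g : ℝ → ℝ} {c d : ℝ≥0∞} (hf : HasCost f c) (hg : HasCost g d) :
    HasCost (fun ε => f ε * g ε) (c + d) := by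
  rcases hf with ⟨rfl, hf⟩ | ⟨r, rfl, L, hL, hf⟩
  · refine Or.inl ⟨by simp, ?_⟩
    filter_upwards [hf] with ε hε
    rw [hε, zero_mul]
  rcases hg with ⟨rfl, hg⟩ | ⟨s, rfl, M, hM, hg⟩
  · refine Or.inl ⟨by simp, ?_⟩
    filter_upwards [hg] with ε hε
    rw [hε, mul_zero]
  refine Or.inr ⟨r + s, by simp, L * M, mul_pos hL hM, (hf.mul hg).congr' ?_⟩
  filter_upwards [self_mem_nhdsWithin] with ε hε
  rw [NNReal.coe_add, neg_add, Real.rpow_add hε]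
  ring

theorem HasResistance.add_of_lt {f g : ℝ → ℝ} {r s : ℝ≥0} (hf : HasResistance f r)
    (hg : HasResistance g s) (hrs : r < s) : HasResistance (fun ε => f ε + g ε) r := by
  obtain ⟨L, hL, hL'⟩ := hf
  refine ⟨L, hL, ?_⟩
  simpa [mul_add] using hL'.add (hg.tendsto_zero hrs)

/-- The term of smaller exponent dominates. Equal exponents cannot cancel, since both limits are
positive. -/
theorem HasCost.add {f g : ℝ → ℝ} {c d : ℝ≥0∞} (hf : HasCost f c) (hg : HasCost g d) :
    HasCost (fun ε => f ε + g ε) (min c d) := by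
  rcases hf with ⟨rfl, hf⟩ | ⟨r, rfl, hf⟩
  · rw [min_eq_right le_top]
    refine hg.congr ?_
    filter_upwards [hf] with ε hε
    rw [hε, zero_add]
  rcases hg with ⟨rfl, hg⟩ | ⟨s, rfl, hg⟩
  · rw [min_eq_left le_top]
    refine HasCost.congr (Or.inr ⟨r, rfl, hf⟩) ?_
    filter_upwards [hg] with ε hε
    rw [hε, add_zero]
  rcases lt_trichotomy r s with h | rfl | h
  · exact Or.inr ⟨r, min_eq_left (by exact_mod_cast h.le), hf.add_of_lt hg h⟩
  · obtain ⟨L, hL, hL'⟩ := hf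
    obtain ⟨M, hM, hM'⟩ := hg
    exact Or.inr ⟨r, min_self _, L + M, add_pos hL hM, by simpa [mul_add] using hL'.add hM'⟩
  · refine Or.inr ⟨s, min_eq_right (by exact_mod_cast h.le), ?_⟩
    simpa [add_comm] using hg.add_of_lt hf h

theorem HasCost.prod {ι : Type*} (s : Finset ι) {f : ι → ℝ → ℝ} {c : ι → ℝ≥0∞}
    (h : ∀ i ∈ s, HasCost (f i) (c i)) : HasCost (fun ε => ∏ i ∈ s, f i ε) (∑ i ∈ s, c i) := by
  classical
  induction s using Finset.induction_on with
  | empty => simpa using HasCost.const one_pos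
  | insert i s hi ih =>
    simp only [Finset.prod_insert hi, Finset.sum_insert hi]
    exact (h i (by simp)).mul (ih fun j hj => h j (by simp [hj]))

theorem HasCost.sum {ι : Type*} (s : Finset ι) {f : ι → ℝ → ℝ} {c : ι → ℝ≥0∞}
    (h : ∀ i ∈ s, HasCost (f i) (c i)) : HasCost (fun ε => ∑ i ∈ s, f i ε) (s.inf c) := by
  classical
  induction s using Finset.induction_on with
  | empty => simpa using HasCost.zero
  | insert i s hi ih =>
    simp only [Finset.sum_insert hi, Finset.inf_insert]
    exact (h i (by simp)).add (ih fun j hj => h j (by simp [hj]))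

end Cost

/-! ### Resistances of the policies -/

section Policies

/-- The resistance of a point mass at `s`. -/
noncomputable def pointCost {S : Type*} (s y : S) : ℝ≥0∞ :=
  open Classical in if y = s then 0 else ∞

@[simp] theorem pointCost_self {S : Type*} (s : S) : pointCost s s = 0 := by simp [pointCost]

theorem pointCost_of_ne {S : Type*} {s y : S} (h : y ≠ s) : pointCost s y = ∞ := by
  simp [pointCost, h]

/-- The resistance of the action policy. -/
noncomputable def actionCost {B : Type*} {V : Set ℝ} : AgentState B V → B → ℝ≥0∞
  | .discontent, _ => 0
  | .bench .content b v, a =>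
      open Classical in if a = b then 0 else if (v : ℝ) < 1 then 1 else ∞
  | .bench _ b _, a => open Classical in if a = b then 0 else ∞

/-- The resistance of the update policy. -/
noncomputable def updateCost {B : Type*} {V : Set ℝ} (F : ℝ → ℝ) (G : ℝ → ℝ → ℝ) :
    AgentState B V → B → V → AgentState B V → ℝ≥0∞
  | .discontent, a, u, y =>
      min (ENNReal.ofReal (F u) + pointCost (.bench .content a u) y) (0 + pointCost .discontent y)
  | .bench .content b v, a, u, y =>
      open Classical in
      if a = b then
        if (v : ℝ) < u then pointCost (.bench .hopeful b v) y
        else if (u : ℝ) < v then pointCost (.bench .watchful b v) y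
        else pointCost (.bench .content b v) y
      else
        if (v : ℝ) < u then
          min (ENNReal.ofReal (G v u) + pointCost (.bench .content a u) y)
            ((if G v u = 0 then ∞ else 0) + pointCost (.bench .content b v) y)
        else pointCost (.bench .content b v) y
  | .bench .hopeful b v, a, u, y =>
      open Classical in
      if (v : ℝ) < u then pointCost (.bench .content a u) y
      else if (u : ℝ) < v then pointCost (.bench .watchful b v) y
      else pointCost (.bench .content b v) y
  | .bench .watchful b v, _, u, y =>
      open Classical in
      if (v : ℝ) < u then pointCost (.bench .hopeful b v) y
      else if (u : ℝ) < v then pointCost .discontent y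
      else pointCost (.bench .content b v) y

theorem hasCost_pointMass {S : Type*} (s y : S) : HasCost (fun _ => pointMass s y)
    (pointCost s y) := by
  unfold pointMass pointCost
  split_ifs
  · exact .const one_pos
  · exact .zero

theorem hasCost_choice {S : Type*} {p : ℝ → ℝ} {c d : ℝ≥0∞} (hp : HasCost p c)
    (hq : HasCost (fun ε => 1 - p ε) d) (s t y : S) :
    HasCost (fun ε => choice (p ε) s t y) (min (c + pointCost s y) (d + pointCost t y)) :=
  (hp.mul (hasCost_pointMass s y)).add (hq.mul (hasCost_pointMass t y))

theorem hasCost_actionProb {B : Type*} [Fintype B] [Nonempty B] {V : Set ℝ}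
    (s : AgentState B V) (a : B) : HasCost (fun ε => actionProb ε s a) (actionCost s a) := by
  rcases s with _ | ⟨_ | _ | _, b, v⟩ <;> simp only [actionProb, actionCost]
  · exact .const (by positivity)
  · have h0 : Tendsto (fun ε : ℝ => ε) (𝓝[>] 0) (𝓝 0) := nhdsWithin_le_nhds
    split_ifs with h1 h2 h2
    · exact .of_tendsto (L := 1 - 0) (by norm_num) (tendsto_const_nhds.sub h0)
    -- Exploration has a target other than `b`, so the denominator `card B - 1` is positive.
    · have : Nontrivial B := ⟨a, b, h2⟩
      have hc : (0 : ℝ) < (Fintype.card B : ℝ) - 1 := by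
        have : 1 < Fintype.card B := Fintype.one_lt_card
        rw [sub_pos]
        exact_mod_cast this
      have := (HasCost.rpow (p := 1) zero_le_one).mul (HasCost.const (inv_pos.2 hc))
      simpa [div_eq_mul_inv] using this
    · exact .const one_pos
    · exact .zero
  all_goals
    split_ifs
    · exact .const one_pos
    · exact .zero

theorem hasCost_min_rpow {p c : ℝ} (hp : 0 ≤ p) (hc : c ∈ Set.Ioo (0 : ℝ) 1) :
    HasCost (fun ε => min (ε ^ p) c) (ENNReal.ofReal p) := by
  rcases hp.eq_or_lt with rfl | hp'
  · simpa [hc.2.le] using HasCost.const hc.1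
  · refine (HasCost.rpow hp).congr ?_
    filter_upwards [(tendsto_rpow_zero_of_pos hp').eventually (gt_mem_nhds hc.1)] with ε hε
    rw [min_eq_left hε.le]

/-- The cap `c < 1` keeps rejection possible at no resistance even when `p = 0`, so staying
discontent is always free. -/
theorem hasCost_one_sub_min_rpow {p c : ℝ} (hp : 0 ≤ p) (hc : c ∈ Set.Ioo (0 : ℝ) 1) :
    HasCost (fun ε => 1 - min (ε ^ p) c) 0 := by
  rcases hp.eq_or_lt with rfl | hp'
  · simpa [hc.2.le] using HasCost.const (sub_pos.2 hc.2)
  · have h := (tendsto_rpow_zero_of_pos hp').min (tendsto_const_nhds (x := c))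
    rw [min_eq_left hc.1.le] at h
    exact .of_tendsto (L := 1 - 0) (by norm_num) (tendsto_const_nhds.sub h)

/-- Without a cap, `p = 0` makes acceptance certain and the alternative impossible. -/
theorem hasCost_one_sub_rpow {p : ℝ} (hp : 0 ≤ p) :
    HasCost (fun ε => 1 - ε ^ p) (if p = 0 then ∞ else 0) := by
  split_ifs with h
  · subst h
    simpa using HasCost.zero
  · exact .of_tendsto (L := 1 - 0) (by norm_num)
      (tendsto_const_nhds.sub (tendsto_rpow_zero_of_pos (hp.lt_of_ne' h)))

theorem hasCost_updateProb {B : Type*} {V : Set ℝ} {F : ℝ → ℝ} {G : ℝ → ℝ → ℝ} {cF : ℝ}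
    (hcF : cF ∈ Set.Ioo (0 : ℝ) 1) (hV : V ⊆ Set.Icc 0 1)
    (hF : ∀ u ∈ Set.Icc (0 : ℝ) 1, 0 ≤ F u)
    (hG : ∀ v ∈ Set.Icc (0 : ℝ) 1, ∀ u ∈ Set.Icc (0 : ℝ) 1, v < u → 0 ≤ G v u)
    (s : AgentState B V) (a : B) (u : V) (y : AgentState B V) :
    HasCost (fun ε => updateProb F G cF ε s a u y) (updateCost F G s a u y) := by
  rcases s with _ | ⟨_ | _ | _, b, v⟩ <;> simp only [updateProb, updateCost]
  · have h := hF u (hV u.2)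
    exact hasCost_choice (hasCost_min_rpow h hcF) (hasCost_one_sub_min_rpow h hcF) _ _ _
  · by_cases h1 : a = b
    · simp only [if_pos h1]
      split_ifs <;> exact hasCost_pointMass _ _
    · simp only [if_neg h1]
      by_cases h2 : (v : ℝ) < u
      · simp only [if_pos h2]
        have h := hG v (hV v.2) u (hV u.2) h2
        exact hasCost_choice (HasCost.rpow h) (hasCost_one_sub_rpow h) _ _ _
      · simp only [if_neg h2]
        exact hasCost_pointMass _ _
  all_goals split_ifs <;> exact hasCost_pointMass _ _

variable {I : Type*} {A : I → Type*} [Fintype I] [DecidableEq I] [∀ i, Fintype (A i)]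
  [∀ i, Nonempty (A i)]

theorem edgeResistance_eq (U : I → (∀ j, A j) → ℝ) (hU : ∀ i a, U i a ∈ Set.Icc (0 : ℝ) 1)
    {F : ℝ → ℝ} {G : ℝ → ℝ → ℝ} {cF : ℝ} (hcF : cF ∈ Set.Ioo (0 : ℝ) 1)
    (hF : ∀ u ∈ Set.Icc (0 : ℝ) 1, 0 ≤ F u)
    (hG : ∀ v ∈ Set.Icc (0 : ℝ) 1, ∀ u ∈ Set.Icc (0 : ℝ) 1, v < u → 0 ≤ G v u)
    (x y : State U) :
    edgeResistance U F G cF x y = ⨅ a : ∀ i, A i, (∑ i, actionCost (x i) (a i)) +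
      ∑ i, updateCost F G (x i) (a i) (observe U i a) (y i) := by
  rw [← Finset.inf_univ_eq_iInf]
  refine HasCost.resistance_eq (HasCost.sum _ fun a _ => ?_)
  refine (HasCost.prod _ fun i _ => hasCost_actionProb _ _).mul
    (HasCost.prod _ fun i _ => hasCost_updateProb hcF ?_ hF hG _ _ _ _)
  rintro _ ⟨b, rfl⟩
  exact hU i b

end Policies

/-! ### Bounds on potentials -/

section Trees

variable {X : Type*} {w : X → X → ℝ≥0∞} {x : X}

/-- If `ψ` decreases by at most `g` along each edge of an `x`-tree, then it decreases by at most the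
total of `g` from any vertex to `x`. -/
theorem IsRootedTree.le_add_sum [Finite X] {T : Finset (X × X)} (h : IsRootedTree w x T) (ψ : X → ℝ≥0∞)
    (g : X × X → ℝ≥0∞) (hg : ∀ e ∈ T, ψ e.1 ≤ ψ e.2 + g e) (s : X) :
    ψ s ≤ ψ x + ∑ e ∈ T, g e := by
  classical
  let E : X → X → Prop := fun a b => (a, b) ∈ T
  -- Restricting the sum to edges met on the way from `s` makes the induction work: by acyclicity,
  -- the first edge is not among those met afterwards.
  suffices H : ∀ s, ψ s ≤ ψ x + ∑ e ∈ T with Relation.ReflTransGen E s e.1, g e from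
    (H s).trans (by gcongr; exact Finset.filter_subset _ _)
  let r : X → X → Prop := fun a b => Relation.TransGen E b a
  have : IsTrans X r := ⟨fun a b c hab hbc => hbc.trans hab⟩
  have : Std.Irrefl r := ⟨fun a => h.acyclic a⟩
  have hwf : WellFounded r := Finite.wellFounded_of_trans_of_irrefl r
  intro s
  induction s using hwf.induction with
  | _ s ih =>
    by_cases hs : s = x
    · subst hs; exact le_self_add
    obtain ⟨z, hz, -⟩ := h.out s hs
    have hsub : insert (s, z) (T.filter fun e => Relation.ReflTransGen E z e.1) ⊆
        T.filter fun e => Relation.ReflTransGen E s e.1 := by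
      intro e he
      rcases Finset.mem_insert.1 he with rfl | he
      · exact Finset.mem_filter.2 ⟨hz, .refl⟩
      · rw [Finset.mem_filter] at he ⊢
        exact ⟨he.1, .head hz he.2⟩
    have hni : (s, z) ∉ T.filter fun e => Relation.ReflTransGen E z e.1 := fun hmem =>
      h.acyclic s (Relation.TransGen.head' hz (Finset.mem_filter.1 hmem).2)
    calc ψ s ≤ ψ z + g (s, z) := hg _ hz
      _ ≤ (ψ x + ∑ e ∈ T with Relation.ReflTransGen E z e.1, g e) + g (s, z) := by
          gcongr; exact ih z (.single hz)
      _ = ψ x + ∑ e ∈ insert (s, z) (T.filter fun e => Relation.ReflTransGen E z e.1), g e := by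
          rw [Finset.sum_insert hni, add_assoc, add_comm (g (s, z))]
      _ ≤ _ := by gcongr

/-- If each vertex `s` may use edges of weight at most `c s` and reaches `x` in this way, then the
total of `c` bounds the potential of `x`. -/
theorem potential_le_sum [Fintype X] {c : X → ℝ≥0∞} (hc : ∀ s, c s ≠ ∞)
    (h : ∀ s, Relation.ReflTransGen (fun s t => w s t ≤ c s) s x) :
    potential w x ≤ ∑ s, c s := by
  classical
  -- `d` is the distance to `x` along affordable edges. Choosing at each vertex an edge that lowers
  -- it yields an acyclic graph.
  obtain ⟨d, hd⟩ : ∃ d : X → ℕ, ∀ s, s ≠ x → ∃ t, w s t ≤ c s ∧ d t < d s := by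
    let P : ℕ → X → Prop := fun n =>
      Nat.rec (fun s => s = x) (fun _ Q s => ∃ t, w s t ≤ c s ∧ Q t) n
    have hP : ∀ s, ∃ n, P n s := fun s => by
      induction h s using Relation.ReflTransGen.head_induction_on with
      | refl => exact ⟨0, rfl⟩
      | head hst _ ih => exact ⟨ih.choose + 1, _, hst, ih.choose_spec⟩
    refine ⟨fun s => sInf {n | P n s}, fun s hs => ?_⟩
    have hspec : P (sInf {n | P n s}) s := Nat.sInf_mem (hP s)
    dsimp only
    generalize sInf {n | P n s} = n at hspec ⊢
    rcases n with _ | n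
    · exact absurd hspec hs
    · obtain ⟨t, ht, hPt⟩ := hspec
      exact ⟨t, ht, Nat.lt_succ_of_le (Nat.sInf_le hPt)⟩
  choose! f hf using hd
  let T : Finset (X × X) := (Finset.univ.erase x).image fun s => (s, f s)
  have hT : ∀ a b, (a, b) ∈ T ↔ a ≠ x ∧ f a = b := fun a b => by
    simp only [T, Finset.mem_image, Finset.mem_erase, Finset.mem_univ, and_true, Prod.mk.injEq]
    constructor
    · rintro ⟨s, hs, rfl, rfl⟩; exact ⟨hs, rfl⟩
    · rintro ⟨ha, rfl⟩; exact ⟨a, ha, rfl, rfl⟩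
  have hdec : ∀ a b, Relation.TransGen (fun a b => (a, b) ∈ T) a b → d b < d a := by
    intro a b hab
    have hstep : ∀ a b, (a, b) ∈ T → d b < d a := fun a b hab => by
      obtain ⟨ha, rfl⟩ := (hT a b).1 hab
      exact (hf a ha).2
    induction hab with
    | single h => exact hstep _ _ h
    | tail _ h ih => exact (hstep _ _ h).trans ih
  have htree : IsRootedTree w x T :=
    { edge := by
        rintro ⟨a, b⟩ he
        obtain ⟨ha, rfl⟩ := (hT a b).1 he
        exact ((hf a ha).1.trans_lt (hc a).lt_top).ne
      out := fun y hy => ⟨f y, (hT _ _).2 ⟨hy, rfl⟩, fun z hz => ((hT _ _).1 hz).2.symm⟩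
      root := fun z hz => ((hT _ _).1 hz).1 rfl
      acyclic := fun y hy => (hdec y y hy).false }
  calc potential w x ≤ ∑ e ∈ T, w e.1 e.2 := iInf₂_le T htree
    _ = ∑ s ∈ Finset.univ.erase x, w s (f s) :=
        Finset.sum_image fun a _ b _ hab => (Prod.mk.inj hab).1
    _ ≤ ∑ s ∈ Finset.univ.erase x, c s :=
        Finset.sum_le_sum fun s hs => (hf s (Finset.ne_of_mem_erase hs)).1
    _ ≤ ∑ s, c s := Finset.sum_le_sum_of_subset (Finset.erase_subset _ _)

end Trees

/-! ### Moves without exploration and without acceptance by discontent agents -/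

section Calm

variable {B : Type*} {V : Set ℝ}

/-- The update of an agent that plays its benchmark action, or stays discontent. -/
noncomputable def calmUpdate : AgentState B V → V → AgentState B V
  | .discontent, _ => .discontent
  | .bench .content b v, u =>
      open Classical in
      if (v : ℝ) < u then .bench .hopeful b v
      else if (u : ℝ) < v then .bench .watchful b v else .bench .content b v
  | .bench .hopeful b v, u =>
      open Classical in
      if (v : ℝ) < u then .bench .content b u
      else if (u : ℝ) < v then .bench .watchful b v else .bench .content b v
  | .bench .watchful b v, u =>
      open Classical in
      if (v : ℝ) < u then .bench .hopeful b v
      else if (u : ℝ) < v then .discontent else .bench .content b v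

/-- `a` is the benchmark action of `s`, unless `s` is discontent. -/
def Agrees (s : AgentState B V) (a : B) : Prop := ∀ m b v, s = .bench m b v → a = b

theorem Agrees.discontent (a : B) : Agrees (.discontent : AgentState B V) a := by
  rintro m b v ⟨⟩

theorem Agrees.bench (m : Mood) (a : B) (v : V) : Agrees (.bench m a v) a := by
  rintro _ _ _ ⟨⟩
  rfl

theorem exists_agrees [Nonempty B] (s : AgentState B V) : ∃ a, Agrees s a := by
  rcases s with _ | ⟨m, b, v⟩
  · exact ⟨Classical.arbitrary B, .discontent _⟩
  · exact ⟨b, .bench _ _ _⟩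

theorem Agrees.actionCost_eq {s : AgentState B V} {a : B} (h : Agrees s a) :
    actionCost s a = 0 := by
  rcases s with _ | ⟨_ | _ | _, b, v⟩
  · rfl
  all_goals
    obtain rfl := h _ _ _ rfl
    simp [actionCost]

theorem Agrees.updateCost_eq {s : AgentState B V} {a : B} (h : Agrees s a) (F : ℝ → ℝ)
    (G : ℝ → ℝ → ℝ) (u : V) : updateCost F G s a u (calmUpdate s u) = 0 := by
  rcases s with _ | ⟨_ | _ | _, b, v⟩
  · simp [updateCost, calmUpdate]
  all_goals
    obtain rfl := h _ _ _ rfl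
    simp only [updateCost, calmUpdate]
    split_ifs <;> simp

theorem Agrees.calmUpdate {s : AgentState B V} {a : B} (h : Agrees s a) (u : V) :
    Agrees (calmUpdate s u) a := by
  rcases s with _ | ⟨_ | _ | _, b, v⟩
  · exact .discontent _
  all_goals
    obtain rfl := h _ _ _ rfl
    simp only [ITEL.calmUpdate]
    split_ifs <;> first | exact .bench _ _ _ | exact .discontent _

/-- Two rounds at a constant utility settle any mood: a higher utility is adopted as benchmark, an
equal one restores content, and a lower one leads through watchful to discontent. -/
theorem calmUpdate_calmUpdate {s : AgentState B V} {a : B} (h : Agrees s a) (u : V) :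
    ITEL.calmUpdate (ITEL.calmUpdate s u) u = .discontent ∨
      ITEL.calmUpdate (ITEL.calmUpdate s u) u = .bench .content a u := by
  rcases s with _ | ⟨m, b, v⟩
  · exact Or.inl rfl
  obtain rfl := h _ _ _ rfl
  rcases lt_trichotomy (v : ℝ) u with hv | hv | hv
  · rcases m <;> simp [ITEL.calmUpdate, Subtype.coe_lt_coe.1 hv]
  · obtain rfl := Subtype.ext hv
    rcases m <;> simp [ITEL.calmUpdate]
  · have hv' := Subtype.coe_lt_coe.1 hv
    rcases m <;> simp [ITEL.calmUpdate, hv', hv'.not_gt]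

theorem calmUpdate_calmUpdate_of_lt {u v : V} (h : (u : ℝ) < v) (b : B) :
    ITEL.calmUpdate (ITEL.calmUpdate (.bench .content b v) u) u = .discontent := by
  simp [ITEL.calmUpdate, h, h.not_gt]

end Calm

/-! ### Free moves and the cheapest exits from aligned states -/

section Edges

variable {I : Type*} {A : I → Type*} [Fintype I] (U : I → (∀ j, A j) → ℝ) (F : ℝ → ℝ)
  (G : ℝ → ℝ → ℝ)

/-- The resistance of a transition: the least resistance of a way to realise it. -/
noncomputable def edgeCost (x y : State U) : ℝ≥0∞ :=
  ⨅ a : ∀ i, A i, (∑ i, actionCost (x i) (a i)) +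
    ∑ i, updateCost F G (x i) (a i) (observe U i a) (y i)

/-- The move to `t` has no resistance. -/
def Free (s t : State U) : Prop := edgeCost U F G s t = 0

/-- The result of the calm updates when the profile `a` is played. -/
noncomputable def calmStep (s : State U) (a : ∀ i, A i) : State U :=
  fun i => calmUpdate (s i) (observe U i a)

/-- The aligned state with benchmark actions `a`. -/
def aligned (a : ∀ i, A i) : State U := fun i => .bench .content (a i) (observe U i a)

variable {U}

theorem free_calmStep {s : State U} {a : ∀ i, A i} (h : ∀ i, Agrees (s i) (a i)) :
    Free U F G s (calmStep U s a) := by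
  refine le_antisymm ((iInf_le _ a).trans ?_) zero_le
  simp [fun i => (h i).actionCost_eq, calmStep, fun i => (h i).updateCost_eq]

theorem free_calmStep_calmStep {s : State U} {a : ∀ i, A i} (h : ∀ i, Agrees (s i) (a i)) :
    Relation.ReflTransGen (Free U F G) s (calmStep U (calmStep U s a) a) :=
  .head (free_calmStep F G h) (.single (free_calmStep F G fun i => (h i).calmUpdate _))

theorem edgeCost_update_le [DecidableEq I] {s : State U} {p : ∀ i, A i} {i : I}
    (h : ∀ k, k ≠ i → Agrees (s k) (p k)) (y : AgentState (A i) (Util U i)) :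
    edgeCost U F G s (Function.update (calmStep U s p) i y) ≤
      actionCost (s i) (p i) + updateCost F G (s i) (p i) (observe U i p) y := by
  refine (iInf_le _ p).trans (add_le_add (le_of_eq ?_) (le_of_eq ?_))
  · exact Finset.sum_eq_single i (fun k _ hk => (h k hk).actionCost_eq) (by simp)
  · rw [Finset.sum_eq_single i (fun k _ hk => ?_) (by simp), Function.update_self]
    rw [Function.update_of_ne hk]
    exact (h k hk).updateCost_eq F G _

variable [DecidableEq I] [∀ i, Nonempty (A i)]

/-- By interdependence, discontent spreads freely to all agents. -/
theorem reach_discontent (hinter : Interdependent U) (s : State U) (h : ∃ i, s i = .discontent) :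
    Relation.ReflTransGen (Free U F G) s (fun _ => .discontent) := by
  classical
  induction hn : (Finset.univ.filter fun i => s i ≠ .discontent).card using Nat.strong_induction_on
    generalizing s with
  | _ n ih =>
    by_cases hall : ∀ i, s i = .discontent
    · rw [funext hall]
    push Not at hall
    obtain ⟨i₀, hi₀⟩ := h
    obtain ⟨i₁, hi₁⟩ := hall
    choose a ha using fun i => exists_agrees (s i)
    -- Discontent agents may play anything for free, so they can realise the change of profile that
    -- interdependence provides and thereby affect an agent outside `J`.
    let J : Finset I := Finset.univ.filter fun i => s i = .discontent
    have hJ : ∀ {i}, i ∈ J ↔ s i = .discontent := by simp [J]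
    obtain ⟨i, hi, a', hne⟩ := hinter a J ⟨i₀, hJ.2 hi₀⟩
      (fun h => hi₁ (hJ.1 (h ▸ Finset.mem_univ _)))
    have hp : ∀ k, Agrees (s k) (J.piecewise a' a k) := fun k => by
      by_cases hk : k ∈ J
      · rw [hJ.1 hk]; exact .discontent _
      · rw [Finset.piecewise_eq_of_notMem _ _ _ hk]; exact ha k
    obtain ⟨lo, hi', hlo, hhi, hlt⟩ : ∃ lo hi' : ∀ i, A i, (∀ k, Agrees (s k) (lo k)) ∧
        (∀ k, Agrees (s k) (hi' k)) ∧ U i lo < U i hi' := by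
      rcases lt_or_gt_of_ne hne with h | h
      · exact ⟨_, _, hp, ha, h⟩
      · exact ⟨_, _, ha, hp, h⟩
    have hlo' : ∀ k, Agrees (calmStep U (calmStep U s hi') hi' k) (lo k) :=
      fun k => ((hlo k).calmUpdate _).calmUpdate _
    -- Two rounds of the better profile leave agent `i` discontent or with benchmark utility `U i
    -- hi'`. Two rounds of the worse one then make it discontent for certain.
    refine (free_calmStep_calmStep F G hhi).trans
      ((free_calmStep_calmStep F G hlo').trans ?_)
    set t := calmStep U (calmStep U (calmStep U (calmStep U s hi') hi') lo) lo with ht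
    have htJ : ∀ k, s k = .discontent → t k = .discontent := fun k hk => by
      simp [ht, calmStep, hk, calmUpdate]
    have hti : t i = .discontent := by
      rcases calmUpdate_calmUpdate (hhi i) (observe U i hi') with h | h
      · simp only [ht, calmStep, h]
        rfl
      · simp only [ht, calmStep, h]
        exact calmUpdate_calmUpdate_of_lt hlt _
    refine ih _ ?_ t ⟨i, hti⟩ rfl
    rw [← hn]
    refine Finset.card_lt_card (Finset.ssubset_iff_of_subset ?_ |>.2 ⟨i, ?_, ?_⟩)
    · exact fun k => by
        simp only [Finset.mem_filter, Finset.mem_univ, true_and]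
        exact mt (htJ k)
    · simpa [hJ] using hi
    · simp [hti]

/-- Two calm rounds settle every agent. Either all are content with the utilities of `a`, or one is
discontent and infects the rest. -/
theorem reach_aligned_or_discontent (hinter : Interdependent U) {s : State U} {a : ∀ i, A i}
    (h : ∀ i, Agrees (s i) (a i)) :
    Relation.ReflTransGen (Free U F G) s (aligned U a) ∨
      Relation.ReflTransGen (Free U F G) s (fun _ => .discontent) := by
  have hs := free_calmStep_calmStep F G h
  by_cases hd : ∃ i, calmStep U (calmStep U s a) a i = .discontent
  · exact Or.inr (hs.trans (reach_discontent F G hinter _ hd))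
  · push Not at hd
    left
    convert hs using 1
    funext i
    exact ((calmUpdate_calmUpdate (h i) _).resolve_left (hd i)).symm

/-- An agent that is not optimally satisfied in an equilibrium state can explore twice in a row and
thereby make an agent discontent. -/
theorem exists_exit_of_isNash (hinter : Interdependent U) (hn : 2 ≤ Fintype.card I)
    {a : ∀ i, A i} (ha : IsNash U a) {i : I} (hi : U i a < 1) :
    ∃ s t, edgeCost U F G (aligned U a) s ≤ 1 ∧ edgeCost U F G s t ≤ 1 ∧
      Relation.ReflTransGen (Free U F G) t (fun _ => .discontent) := by
  obtain ⟨j, hj, a', hne⟩ := hinter a {i} (Finset.singleton_nonempty i) (fun h => by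
    have := congrArg Finset.card h
    rw [Finset.card_singleton, Finset.card_univ] at this
    omega)
  rw [Finset.piecewise_singleton] at hne
  rw [Finset.mem_singleton] at hj
  have hb : a' i ≠ a i := fun h => hne (by rw [h, Function.update_eq_self])
  set p := Function.update a i (a' i) with hp
  have hpi : p i = a' i := Function.update_self ..
  have hpk : ∀ k, k ≠ i → p k = a k := fun k hk => Function.update_of_ne hk ..
  have hUi : U i p ≤ U i a := ha i _ hb
  -- At an equilibrium the deviation of `i` does not pay, so `i` reverts for free after exploring
  -- and can repeat the same exploration at cost 1.
  have hexp : ∀ s : State U, (∀ k, k ≠ i → Agrees (s k) (p k)) → s i = aligned U a i →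
      edgeCost U F G s (Function.update (calmStep U s p) i (aligned U a i)) ≤ 1 := by
    intro s hs hsi
    refine (edgeCost_update_le F G hs _).trans (le_of_eq ?_)
    simp [hsi, aligned, actionCost, updateCost, hpi, hb, observe, hi, hUi.not_gt]
  set s := Function.update (calmStep U (aligned U a) p) i (aligned U a i) with hs
  set t := Function.update (calmStep U s p) i (aligned U a i) with ht
  have hal : ∀ k, Agrees (aligned U a k) (a k) := fun k => .bench _ _ _
  have hsA : ∀ k, Agrees (s k) (a k) := fun k => by
    by_cases hk : k = i
    · subst hk; rw [hs, Function.update_self]; exact hal _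
    · rw [hs, Function.update_of_ne hk]; exact (hal k).calmUpdate _
  have htA : ∀ k, Agrees (t k) (a k) := fun k => by
    by_cases hk : k = i
    · subst hk; rw [ht, Function.update_self]; exact hal _
    · rw [ht, Function.update_of_ne hk]; exact (hsA k).calmUpdate _
  have htj : t j = calmUpdate (calmUpdate (aligned U a j) (observe U j p)) (observe U j p) := by
    rw [ht, Function.update_of_ne hj, calmStep, hs, Function.update_of_ne hj, calmStep]
  refine ⟨s, t, hexp _ (fun k hk => hpk k hk ▸ hal k) rfl,
    hexp _ (fun k hk => hpk k hk ▸ hsA k) (by rw [hs, Function.update_self]), ?_⟩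
  -- If `j` loses, the two explorations take it through watchful to discontent. If `j` gains, they
  -- raise its benchmark, and returning to `a` then disappoints it.
  rcases lt_or_gt_of_ne hne with hlt | hlt
  · refine reach_discontent F G hinter _ ⟨j, ?_⟩
    rw [htj]
    exact calmUpdate_calmUpdate_of_lt hlt _
  · rcases calmUpdate_calmUpdate (hal j) (observe U j p) with h | h
    · exact reach_discontent F G hinter _ ⟨j, htj.trans h⟩
    · refine (free_calmStep_calmStep F G htA).trans (reach_discontent F G hinter _ ⟨j, ?_⟩)
      simp only [calmStep]
      rw [htj, h]
      exact calmUpdate_calmUpdate_of_lt hlt _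

/-- Accepting a better reply leads freely either to general discontent or to an aligned state of
larger total utility. -/
theorem exists_exit_of_lt (hinter : Interdependent U) (hU : ∀ i a, U i a ≤ 1)
    {a : ∀ i, A i} {i : I} {b : A i} (hb : b ≠ a i) (hlt : U i a < U i (Function.update a i b)) :
    ∃ t, edgeCost U F G (aligned U a) t ≤
        1 + ENNReal.ofReal (G (U i a) (U i (Function.update a i b))) ∧
      (Relation.ReflTransGen (Free U F G) t (fun _ => .discontent) ∨
        ∃ p, ∑ k, U k a < ∑ k, U k p ∧
          Relation.ReflTransGen (Free U F G) t (aligned U p)) := by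
  set p := Function.update a i b with hp
  have hpi : p i = b := Function.update_self ..
  have hpk : ∀ k, k ≠ i → p k = a k := fun k hk => Function.update_of_ne hk ..
  have hal : ∀ k, Agrees (aligned U a k) (a k) := fun k => .bench _ _ _
  set t := Function.update (calmStep U (aligned U a) p) i (.bench .content b (observe U i p))
    with ht
  refine ⟨t, (edgeCost_update_le F G (fun k hk => hpk k hk ▸ hal k) _).trans
    (add_le_add (le_of_eq ?_) ?_), ?_⟩
  · simp [aligned, actionCost, hpi, hb, observe, hlt.trans_le (hU i p)]
  · simp only [aligned, updateCost, hpi, hb, if_false]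
    rw [if_pos (show ((observe U i a : Util U i) : ℝ) < observe U i p from hlt)]
    exact (min_le_left _ _).trans (by simp [observe])
  · have htA : ∀ k, Agrees (t k) (p k) := fun k => by
      by_cases hk : k = i
      · subst hk; rw [ht, Function.update_self, hpi]; exact .bench _ _ _
      · rw [ht, Function.update_of_ne hk, hpk k hk]; exact (hal k).calmUpdate _
    -- A losing agent is already watchful in `t`, and one more free round at `p` makes it
    -- discontent. If nobody loses, the gain of `i` makes the total utility strictly larger.
    by_cases hdec : ∃ k, U k p < U k a
    · obtain ⟨k, hk⟩ := hdec
      have hki : k ≠ i := by rintro rfl; exact hk.not_gt hlt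
      refine Or.inl (.head (free_calmStep F G htA) (reach_discontent F G hinter _ ⟨k, ?_⟩))
      rw [calmStep, ht, Function.update_of_ne hki]
      exact calmUpdate_calmUpdate_of_lt hk _
    · push Not at hdec
      rcases reach_aligned_or_discontent F G hinter htA with h | h
      · exact Or.inr ⟨p, Finset.sum_lt_sum (fun k _ => hdec k) ⟨i, Finset.mem_univ _, hlt⟩, h⟩
      · exact Or.inl h

end Edges

/-! ### The potential of aligned states -/

section Finiteness

instance : Finite Mood :=
  Finite.of_injective (β := Fin 3)
    (fun m => match m with | .content => 0 | .hopeful => 1 | .watchful => 2)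
    (by rintro (_ | _ | _) (_ | _ | _) h <;> first | rfl | cases h)

instance {B V : Type*} [Finite B] [Finite V] : Finite (AgentState B V) :=
  Finite.of_injective (β := Option (Mood × B × V))
    (fun s => match s with | .discontent => none | .bench m b v => some (m, b, v))
    (by rintro (_ | ⟨m, b, v⟩) (_ | ⟨m', b', v'⟩) h <;> simp_all)

end Finiteness

/-! ### Exit costs and the upper bound on the potential -/

section Potential

variable {I : Type*} {A : I → Type*} [DecidableEq I] (U : I → (∀ j, A j) → ℝ)
  (F : ℝ → ℝ) (G : ℝ → ℝ → ℝ)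

/-- The values of `G` at the better replies of single agents to `a`. -/
def gainCosts (a : ∀ i, A i) : Set ℝ :=
  {g | ∃ i, ∃ b : A i, b ≠ a i ∧ U i a < U i (Function.update a i b) ∧
    g = G (U i a) (U i (Function.update a i b))}

/-- The resistance of leaving the aligned state with benchmark actions `a`. -/
noncomputable def exitCost (a : ∀ i, A i) : ℝ≥0∞ :=
  open Classical in if IsNash U a then 2 else 1 + ENNReal.ofReal (sInf (gainCosts U G a))

theorem gainCosts_nonempty {a : ∀ i, A i} (ha : ¬ IsNash U a) : (gainCosts U G a).Nonempty := by
  simp only [IsNash, not_forall, not_le] at ha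
  obtain ⟨i, b, hb, hlt⟩ := ha
  exact ⟨_, i, b, hb, hlt, rfl⟩

theorem finite_gainCosts [Finite I] [∀ i, Finite (A i)] (a : ∀ i, A i) : (gainCosts U G a).Finite := by
  refine (Set.finite_range fun q : Σ i, A i =>
    G (U q.1 a) (U q.1 (Function.update a q.1 q.2))).subset ?_
  rintro _ ⟨i, b, -, -, rfl⟩
  exact ⟨⟨i, b⟩, rfl⟩

theorem sInf_gainCosts_mem [Finite I] [∀ i, Finite (A i)] {a : ∀ i, A i} (ha : ¬ IsNash U a) :
    sInf (gainCosts U G a) ∈ gainCosts U G a :=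
  (gainCosts_nonempty U G ha).csInf_mem (finite_gainCosts U G a)

theorem one_le_exitCost (a : ∀ i, A i) : 1 ≤ exitCost U G a := by
  unfold exitCost
  split_ifs
  · exact one_le_two
  · exact le_self_add

theorem exitCost_ne_top (a : ∀ i, A i) : exitCost U G a ≠ ∞ := by
  unfold exitCost
  split_ifs <;> simp

theorem exitCost_le_two [Finite I] [∀ i, Finite (A i)] (hG : ∀ g a, g ∈ gainCosts U G a → g ≤ 1)
    (a : ∀ i, A i) : exitCost U G a ≤ 2 := by
  unfold exitCost
  split_ifs with h
  · exact le_rfl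
  · rw [← one_add_one_eq_two]
    gcongr
    exact ENNReal.ofReal_le_one.2 (hG _ a (sInf_gainCosts_mem U G h))

theorem exitCost_le [Finite I] [∀ i, Finite (A i)] {a : ∀ i, A i} {i : I} {b : A i} (hb : b ≠ a i)
    (hlt : U i a < U i (Function.update a i b)) :
    exitCost U G a ≤ 1 + ENNReal.ofReal (G (U i a) (U i (Function.update a i b))) := by
  rw [exitCost, if_neg fun h => (h i b hb).not_gt hlt]
  gcongr
  exact csInf_le (finite_gainCosts U G a).bddBelow ⟨i, b, hb, hlt, rfl⟩

variable [Fintype I] [∀ i, Fintype (A i)] {U}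

/-- Each aligned state other than the root spends its exit cost, general discontent spends the
acceptance cost of `a`, and all other moves are free. The term `exitCost U G a` stands on the left
to avoid truncated subtraction. -/
theorem potential_aligned_add_le [∀ i, Nonempty (A i)] (hinter : Interdependent U)
    (hn : 2 ≤ Fintype.card I) (hU : ∀ i a, U i a ≤ 1) (hopt : ∀ a, ∃ i, U i a < 1)
    (a : ∀ i, A i) :
    potential (edgeCost U F G) (aligned U a) + exitCost U G a ≤
      ∑ b, exitCost U G b + ∑ i, ENNReal.ofReal (F (U i a)) := by
  classical
  have : Fintype (State U) := Fintype.ofFinite _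
  have hnash : ∀ b, ∃ s t, IsNash U b → edgeCost U F G (aligned U b) s ≤ 1 ∧
      edgeCost U F G s t ≤ 1 ∧
      Relation.ReflTransGen (Free U F G) t (fun _ => .discontent) := fun b => by
    by_cases hb : IsNash U b
    · obtain ⟨i, hi⟩ := hopt b
      obtain ⟨s, t, h⟩ := exists_exit_of_isNash F G hinter hn hb hi
      exact ⟨s, t, fun _ => h⟩
    · exact ⟨aligned U b, aligned U b, fun h => absurd h hb⟩
  choose s₁ s₂ hs using hnash
  -- `k b` distributes the budget `exitCost U G b`: at an equilibrium, one unit for each of the two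
  -- explorations, which start at different places; otherwise everything at the aligned state.
  let k : (∀ i, A i) → State U → ℝ≥0∞ := fun b v =>
    if b = a then 0 else if IsNash U b then
      (if v = aligned U b then 1 else 0) + (if v = s₁ b then 1 else 0)
    else if v = aligned U b then exitCost U G b else 0
  let D : State U := fun _ => .discontent
  let c : State U → ℝ≥0∞ := fun v =>
    ∑ b, k b v + if v = D then ∑ i, ENNReal.ofReal (F (U i a)) else 0
  have hk : ∀ b v, k b v ≤ c v := fun b v =>
    (Finset.single_le_sum (f := fun b => k b v) (fun _ _ => zero_le) (Finset.mem_univ b)).trans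
      le_self_add
  have hsum : ∑ v, c v + exitCost U G a =
      ∑ b, exitCost U G b + ∑ i, ENNReal.ofReal (F (U i a)) := by
    have hkb : ∀ b, ∑ v, k b v = if b = a then 0 else exitCost U G b := fun b => by
      simp only [k]
      split_ifs with h1 h2
      · simp
      · simp [Finset.sum_add_distrib, exitCost, h2, one_add_one_eq_two]
      · simp
    have hsplit : ∑ b, exitCost U G b =
        ∑ b, (if b = a then 0 else exitCost U G b) + exitCost U G a := by
      have : ∀ b, exitCost U G b = (if b = a then 0 else exitCost U G b) +
          if b = a then exitCost U G a else 0 := fun b => by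
        split_ifs with h
        · rw [h, zero_add]
        · rw [add_zero]
      rw [Finset.sum_congr rfl fun b _ => this b, Finset.sum_add_distrib]
      simp
    simp only [c, Finset.sum_add_distrib, Finset.sum_ite_eq', Finset.mem_univ, if_true]
    rw [Finset.sum_comm, Finset.sum_congr rfl fun b _ => hkb b, hsplit]
    ring
  have hc : ∀ v, c v ≠ ∞ := fun v => by
    refine ENNReal.add_ne_top.2 ⟨ENNReal.sum_ne_top.2 fun b _ => ?_, ?_⟩
    · simp only [k]
      split_ifs <;> simp [exitCost_ne_top]
    · split_ifs <;> simp
  have hfree : ∀ {s t : State U}, Relation.ReflTransGen (Free U F G) s t →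
      Relation.ReflTransGen (fun s t => edgeCost U F G s t ≤ c s) s t := fun h =>
    Relation.ReflTransGen.mono (fun _ _ (hst : Free U F G _ _) => (le_of_eq hst).trans zero_le) _ _ h
  have hD : Relation.ReflTransGen (fun s t => edgeCost U F G s t ≤ c s) D (aligned U a) := by
    refine .single ?_
    have : ∑ i, ENNReal.ofReal (F (U i a)) ≤ c D := by simp [c]
    refine (iInf_le _ a).trans (le_trans ?_ this)
    refine (add_le_add (le_of_eq (Finset.sum_eq_zero fun i _ => rfl))
      (Finset.sum_le_sum fun i _ => ?_)).trans_eq (zero_add _)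
    exact (min_le_left _ _).trans (by simp [aligned, observe])
  have hal : ∀ b, Relation.ReflTransGen (fun s t => edgeCost U F G s t ≤ c s)
      (aligned U b) (aligned U a) := by
    -- A cheapest better reply leads to discontent or to an aligned state of larger total utility.
    -- There are finitely many profiles, so chains of the second kind end.
    let r : (∀ i, A i) → (∀ i, A i) → Prop := fun p q => ∑ i, U i q < ∑ i, U i p
    have : IsTrans _ r := ⟨fun _ _ _ h h' => lt_trans (b := _) h' h⟩
    have : Std.Irrefl r := ⟨fun _ => lt_irrefl _⟩
    have hwf : WellFounded r := Finite.wellFounded_of_trans_of_irrefl r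
    intro b
    induction b using hwf.induction with
    | _ b ih =>
      by_cases hba : b = a
      · rw [hba]
      by_cases hb : IsNash U b
      · obtain ⟨h1, h2, h3⟩ := hs b hb
        refine .head (h1.trans (le_trans ?_ (hk b _))) (.head (h2.trans (le_trans ?_ (hk b _)))
          ((hfree h3).trans hD))
        · simp [k, hba, hb]
        · simp [k, hba, hb]
      · obtain ⟨i, q, hq, hlt, hg⟩ := sInf_gainCosts_mem U G hb
        obtain ⟨t, ht, h⟩ := exists_exit_of_lt F G hinter hU hq hlt
        refine .head (ht.trans (le_trans ?_ (hk b _))) ?_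
        · simp [k, hba, hb, exitCost, hg]
        · rcases h with h | ⟨p, hp, h⟩
          · exact (hfree h).trans hD
          · exact (hfree h).trans (ih p hp)
  rw [← hsum]
  gcongr
  refine potential_le_sum hc fun s => ?_
  choose b hb using fun i => exists_agrees (s i)
  rcases reach_aligned_or_discontent F G hinter hb with h | h
  · exact (hfree h).trans (hal b)
  · exact (hfree h).trans hD

end Potential

/-! ### Lower bounds -/

section Lower

/-- An agent that sees its benchmark utility again after playing its benchmark action reverts,
whatever its mood. -/
theorem updateCost_bench_self {B : Type*} {V : Set ℝ} (F : ℝ → ℝ) (G : ℝ → ℝ → ℝ) (m : Mood)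
    (b : B) (v : V) {y : AgentState B V} (h : y ≠ .bench .content b v) :
    updateCost F G (.bench m b v) b v y = ∞ := by
  rcases m <;> simp [updateCost, pointCost_of_ne h]

theorem updateCost_content_same {B : Type*} {V : Set ℝ} (F : ℝ → ℝ) (G : ℝ → ℝ → ℝ)
    (b : B) (u v : V) {y : AgentState B V} (h : ∀ m, y ≠ .bench m b v) :
    updateCost F G (.bench .content b v) b u y = ∞ := by
  simp only [updateCost, if_true]
  split_ifs <;> exact pointCost_of_ne (h _)

theorem one_le_actionCost {B : Type*} {V : Set ℝ} (m : Mood) {a b : B} (v : V) (h : a ≠ b) :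
    1 ≤ actionCost (.bench m b v) a := by
  rcases m <;> simp only [actionCost, if_neg h]
  · split_ifs <;> simp
  all_goals simp

/-- A lower bound on the resistance of reaching benchmark utility `t`. -/
noncomputable def acceptanceGap {B : Type*} {V : Set ℝ} (F : ℝ → ℝ) (t : ℝ) :
    AgentState B V → ℝ≥0∞
  | .discontent => ENNReal.ofReal (F t)
  | .bench _ _ u => ENNReal.ofReal (F t - F u)

/-- An agent that is not discontent changes its benchmark utility only upwards, which cannot
increase `F`; becoming discontent forgets the term `F v ≥ 0`. Neither lowers the gap. -/
theorem acceptanceGap_bench_le {B : Type*} {V : Set ℝ} {F : ℝ → ℝ} {G : ℝ → ℝ → ℝ}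
    (hF : AntitoneOn F (Set.Icc 0 1)) (hF0 : ∀ u ∈ Set.Icc (0 : ℝ) 1, 0 ≤ F u)
    (hV : V ⊆ Set.Icc 0 1) (t : ℝ) {m : Mood} {a b : B} {u v : V} {y : AgentState B V}
    (h : updateCost F G (.bench m b v) a u y ≠ ∞) :
    acceptanceGap F t (.bench m b v) ≤ acceptanceGap F t y := by
  have hsame : ∀ m', acceptanceGap F t (.bench m b v) ≤ acceptanceGap F t (.bench m' b v) :=
    fun _ => le_rfl
  have hacc : (v : ℝ) < u → ∀ m', acceptanceGap F t (.bench m b v) ≤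
      acceptanceGap F t (.bench m' a u) := fun hvu _ =>
    ENNReal.ofReal_le_ofReal (sub_le_sub_left (hF (hV v.2) (hV u.2) hvu.le) _)
  have hdis : acceptanceGap F t (.bench m b v) ≤
      acceptanceGap F t (.discontent : AgentState B V) :=
    ENNReal.ofReal_le_ofReal (sub_le_self _ (hF0 _ (hV v.2)))
  have hpt : ∀ {s : AgentState B V}, pointCost s y ≠ ∞ → y = s := fun hs => by
    by_contra hne
    exact hs (pointCost_of_ne hne)
  rcases m with _ | _ | _ <;> simp only [updateCost] at h
  · by_cases hab : a = b
    · simp only [if_pos hab] at h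
      split_ifs at h <;> rw [hpt h] <;> exact hsame _
    · simp only [if_neg hab] at h
      by_cases hvu : (v : ℝ) < u
      · simp only [if_pos hvu] at h
        by_cases hy : y = .bench .content a u
        · rw [hy]; exact hacc hvu _
        by_cases hy' : y = .bench .content b v
        · rw [hy']
        · simp [pointCost_of_ne hy, pointCost_of_ne hy'] at h
      · simp only [if_neg hvu] at h
        rw [hpt h]
  · split_ifs at h with h1 <;> rw [hpt h]
    · exact hacc h1 _
    all_goals exact hsame _
  · split_ifs at h <;> rw [hpt h]
    · exact hsame _
    · exact hdis
    · exact hsame _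

/-- Only acceptance by a discontent agent can lower the gap. It costs `F u`, which covers the drop
from `F t` to the positive part of `F t - F u`. -/
theorem acceptanceGap_le {B : Type*} {V : Set ℝ} {F : ℝ → ℝ} {G : ℝ → ℝ → ℝ}
    (hF : AntitoneOn F (Set.Icc 0 1)) (hF0 : ∀ u ∈ Set.Icc (0 : ℝ) 1, 0 ≤ F u)
    (hV : V ⊆ Set.Icc 0 1) (t : ℝ) (s : AgentState B V) (a : B) (u : V) (y : AgentState B V) :
    acceptanceGap F t s ≤ acceptanceGap F t y + updateCost F G s a u y := by
  by_cases h : updateCost F G s a u y = ∞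
  · simp [h]
  rcases s with _ | ⟨m, b, v⟩
  · by_cases hy : y = .discontent
    · rw [hy]; exact le_self_add
    by_cases hy' : y = .bench .content a u
    · have hyd : (AgentState.bench .content a u : AgentState B V) ≠ .discontent := nofun
      simp only [hy', updateCost, pointCost_self, acceptanceGap, pointCost_of_ne hyd, add_zero,
        add_top, min_eq_left le_top]
      simpa using ENNReal.ofReal_add_le (p := F t - F u) (q := F u)
    · exact absurd (by simp [updateCost, pointCost_of_ne hy, pointCost_of_ne hy']) h
  · exact (acceptanceGap_bench_le hF hF0 hV t h).trans le_self_add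

end Lower

/-! ### Lower bounds on tree weights by duality -/

section Bounds

variable {I : Type*} {A : I → Type*} {U : I → (∀ j, A j) → ℝ} {F : ℝ → ℝ}
  {G : ℝ → ℝ → ℝ}

/-- The states with the benchmarks of the aligned state at `b`, and with arbitrary moods. -/
def near (U : I → (∀ j, A j) → ℝ) (b : ∀ i, A i) : Set (State U) :=
  {s | ∀ i, ∃ m, s i = .bench m (b i) (observe U i b)}

theorem aligned_mem_near (b : ∀ i, A i) : aligned U b ∈ near U b := fun _ => ⟨_, rfl⟩

theorem eq_of_mem_near {b c : ∀ i, A i} {s : State U} (hb : s ∈ near U b) (hc : s ∈ near U c) :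
    b = c := by
  funext i
  obtain ⟨m, hm⟩ := hb i
  obtain ⟨m', hm'⟩ := hc i
  rw [hm] at hm'
  injection hm'

variable [Fintype I]

/-- If everyone plays its benchmark, all utilities recur and every agent reverts, which gives
`aligned U b`. Any other outcome needs an agent to deviate, at cost at least 1. -/
theorem one_le_edgeCost {b : ∀ i, A i} {s t : State U} (hs : s ∈ near U b)
    (ht : t ≠ aligned U b) : 1 ≤ edgeCost U F G s t := by
  refine le_iInf fun p => ?_
  by_cases hp : p = b
  · subst hp
    obtain ⟨i, hi⟩ := Function.ne_iff.1 ht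
    obtain ⟨m, hm⟩ := hs i
    have : ∑ i, updateCost F G (s i) (p i) (observe U i p) (t i) = ∞ :=
      ENNReal.sum_eq_top.2 ⟨i, Finset.mem_univ _, by
        rw [hm]; exact updateCost_bench_self F G _ _ _ hi⟩
    simp [this]
  · obtain ⟨i, hi⟩ := Function.ne_iff.1 hp
    obtain ⟨m, hm⟩ := hs i
    calc 1 ≤ actionCost (s i) (p i) := by rw [hm]; exact one_le_actionCost _ _ hi
      _ ≤ ∑ i, actionCost (s i) (p i) :=
        Finset.single_le_sum (f := fun i => actionCost (s i) (p i)) (fun _ _ => zero_le)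
          (Finset.mem_univ i)
      _ ≤ _ := le_self_add

/-- The agent `k` whose benchmark is lost must have explored, because playing the benchmark changes
only the mood of a content agent. A second explorer brings the cost to 2, the largest exit cost;
alone, `k` must accept a better reply. -/
theorem exitCost_le_edgeCost [DecidableEq I] [∀ i, Finite (A i)]
    (hG : ∀ g a, g ∈ gainCosts U G a → g ≤ 1) {b : ∀ i, A i} {t : State U} (ht : t ∉ near U b) :
    exitCost U G b ≤ edgeCost U F G (aligned U b) t := by
  refine le_iInf fun p => ?_
  have hact : ∀ i, p i ≠ b i → 1 ≤ actionCost (aligned U b i) (p i) :=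
    fun i hi => one_le_actionCost _ _ hi
  simp only [near, Set.mem_ofPred_eq, not_forall, not_exists] at ht
  obtain ⟨k, hk⟩ := ht
  by_cases hpk : p k = b k
  · have : ∑ i, updateCost F G (aligned U b i) (p i) (observe U i p) (t i) = ∞ :=
      ENNReal.sum_eq_top.2 ⟨k, Finset.mem_univ _, by
        rw [hpk]; exact updateCost_content_same F G _ _ _ hk⟩
    simp [this]
  by_cases hex : ∃ i, i ≠ k ∧ p i ≠ b i
  · obtain ⟨i, hik, hi⟩ := hex
    calc exitCost U G b ≤ 2 := exitCost_le_two U G hG b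
      _ = 1 + 1 := one_add_one_eq_two.symm
      _ ≤ actionCost (aligned U b i) (p i) + actionCost (aligned U b k) (p k) :=
        add_le_add (hact i hi) (hact k hpk)
      _ = ∑ j ∈ {i, k}, actionCost (aligned U b j) (p j) :=
        (Finset.sum_pair (f := fun j => actionCost (aligned U b j) (p j)) hik).symm
      _ ≤ ∑ j, actionCost (aligned U b j) (p j) :=
        Finset.sum_le_sum_of_subset (Finset.subset_univ _)
      _ ≤ _ := le_self_add
  · push Not at hex
    have hp : p = Function.update b k (p k) := by
      funext i
      by_cases hik : i = k
      · subst hik; rw [Function.update_self]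
      · rw [Function.update_of_ne hik, hex i hik]
    have hupd : exitCost U G b ≤ 1 + updateCost F G (aligned U b k) (p k) (observe U k p) (t k) := by
      by_cases hlt : U k b < U k p
      · have hlt' : ((observe U k b : Util U k) : ℝ) < observe U k p := hlt
        refine (exitCost_le U G hpk (hp ▸ hlt)).trans ?_
        rw [← hp]
        gcongr
        simp only [aligned, updateCost, if_neg hpk, if_pos hlt', pointCost_of_ne (hk .content)]
        simp [observe]
      · have hlt' : ¬ ((observe U k b : Util U k) : ℝ) < observe U k p := hlt
        simp only [aligned, updateCost, if_neg hpk, if_neg hlt', pointCost_of_ne (hk .content)]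
        simp
    refine hupd.trans (add_le_add ((hact k hpk).trans ?_) ?_)
    · exact Finset.single_le_sum (f := fun i => actionCost (aligned U b i) (p i))
        (fun _ _ => zero_le) (Finset.mem_univ k)
    · exact Finset.single_le_sum
        (f := fun i => updateCost F G (aligned U b i) (p i) (observe U i p) (t i))
        (fun _ _ => zero_le) (Finset.mem_univ k)

theorem sum_acceptanceGap_le (hF : AntitoneOn F (Set.Icc 0 1))
    (hF0 : ∀ u ∈ Set.Icc (0 : ℝ) 1, 0 ≤ F u) (hU : ∀ i a, U i a ∈ Set.Icc (0 : ℝ) 1)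
    (τ : I → ℝ) (s t : State U) :
    ∑ i, acceptanceGap F (τ i) (s i) ≤
      ∑ i, acceptanceGap F (τ i) (t i) + edgeCost U F G s t := by
  have hV : ∀ i, Set.range (U i) ⊆ Set.Icc (0 : ℝ) 1 := by
    rintro i _ ⟨a, rfl⟩
    exact hU i a
  rw [edgeCost, ENNReal.add_iInf]
  refine le_iInf fun p => ?_
  calc ∑ i, acceptanceGap F (τ i) (s i)
      ≤ ∑ i, (acceptanceGap F (τ i) (t i) +
          updateCost F G (s i) (p i) (observe U i p) (t i)) :=
        Finset.sum_le_sum fun i _ => acceptanceGap_le hF hF0 (hV i) _ _ _ _ _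
    _ ≤ _ := by
        rw [Finset.sum_add_distrib]
        gcongr
        exact le_add_self

theorem sum_acceptanceGap_le_of_mem_near (hF : AntitoneOn F (Set.Icc 0 1))
    (hF0 : ∀ u ∈ Set.Icc (0 : ℝ) 1, 0 ≤ F u) (hU : ∀ i a, U i a ∈ Set.Icc (0 : ℝ) 1)
    (τ : I → ℝ) {b : ∀ i, A i} {s t : State U} (hs : s ∈ near U b)
    (hst : edgeCost U F G s t ≠ ∞) :
    ∑ i, acceptanceGap F (τ i) (s i) ≤ ∑ i, acceptanceGap F (τ i) (t i) := by
  have hV : ∀ i, Set.range (U i) ⊆ Set.Icc (0 : ℝ) 1 := by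
    rintro i _ ⟨a, rfl⟩
    exact hU i a
  obtain ⟨p, hp⟩ := not_forall.1 (mt iInf_eq_top.2 hst)
  refine Finset.sum_le_sum fun i _ => ?_
  have h := ENNReal.sum_ne_top.1 (ENNReal.add_ne_top.1 hp).2 i (Finset.mem_univ i)
  obtain ⟨m, hm⟩ := hs i
  rw [hm] at h ⊢
  exact acceptanceGap_bench_le hF hF0 (hV i) _ h

open Classical in
/-- Potential function for the exit from `near U b`. -/
noncomputable def exitGap [DecidableEq I] (U : I → (∀ j, A j) → ℝ) (G : ℝ → ℝ → ℝ) (b : ∀ i, A i)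
    (s : State U) : ℝ≥0∞ :=
  if s = aligned U b then exitCost U G b
  else if s ∈ near U b then exitCost U G b - 1 else 0

open Classical in
-- `exitGap` drops by at most the weight of any edge leaving `near U b` and is zero at all other
-- tails, so the tree path from `aligned U b` pays for the total drop.
theorem exitCost_le_of_isRootedTree [DecidableEq I] [∀ i, Finite (A i)]
    (hG : ∀ g a, g ∈ gainCosts U G a → g ≤ 1) {x : State U} {T : Finset (State U × State U)}
    (hT : IsRootedTree (edgeCost U F G) x T) (b : ∀ i, A i) :
    exitCost U G b ≤ exitGap U G b x +
      ∑ e ∈ T, if e.1 ∈ near U b then edgeCost U F G e.1 e.2 else 0 := by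
  have h := hT.le_add_sum (exitGap U G b)
    (fun e => if e.1 ∈ near U b then edgeCost U F G e.1 e.2 else 0) ?_ (aligned U b)
  · simpa [exitGap] using h
  rintro ⟨s, t⟩ -
  have h1 : exitCost U G b - 1 ≤ exitGap U G b t + edgeCost U F G s t ∨ s ∉ near U b := by
    by_cases hs : s ∈ near U b
    · left
      by_cases ht : t = aligned U b
      · simp only [exitGap, if_pos ht]
        exact tsub_le_self.trans le_self_add
      · refine le_trans ?_ le_add_self
        refine le_trans ?_ (one_le_edgeCost hs ht)
        -- Away from `aligned U b` the remaining gap is at most 1, as exit costs are at most 2. One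
        -- deviation pays for it.
        rw [tsub_le_iff_right, one_add_one_eq_two]
        exact exitCost_le_two U G hG b
    · exact Or.inr hs
  by_cases hs : s ∈ near U b
  · simp only [if_pos hs]
    replace h1 := h1.resolve_right (not_not.2 hs)
    by_cases hsb : s = aligned U b
    · subst hsb
      by_cases ht : t = aligned U b
      · rw [ht]; exact le_self_add
      by_cases htn : t ∈ near U b
      · simp only [exitGap, if_true, if_neg ht, if_pos htn]
        calc exitCost U G b ≤ exitCost U G b - 1 + 1 := le_tsub_add
          _ ≤ _ := by gcongr; exact one_le_edgeCost hs ht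
      · simp only [exitGap, if_true]
        exact (exitCost_le_edgeCost hG htn).trans le_add_self
    · simpa only [exitGap, if_neg hsb, if_pos hs] using h1
  · have hsb : s ≠ aligned U b := by rintro rfl; exact hs (aligned_mem_near b)
    simp [exitGap, hsb, hs]

variable [DecidableEq I] [∀ i, Fintype (A i)]

open Classical in
-- The sets `near U b` are pairwise disjoint, so sorting the edges by their tails adds the exit
-- bounds without counting an edge twice. Edges with tails outside all these sets remain available
-- for another bound.
theorem sum_exitCost_add_le (hG : ∀ g a, g ∈ gainCosts U G a → g ≤ 1) {x : State U}
    {T : Finset (State U × State U)} (hT : IsRootedTree (edgeCost U F G) x T) :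
    ∑ b, exitCost U G b +
        ∑ e ∈ T, (if ∃ b, e.1 ∈ near U b then 0 else edgeCost U F G e.1 e.2) ≤
      ∑ b, exitGap U G b x + ∑ e ∈ T, edgeCost U F G e.1 e.2 := by
  have key : ∀ e ∈ T, (∑ b, if e.1 ∈ near U b then edgeCost U F G e.1 e.2 else 0) +
      (if ∃ b, e.1 ∈ near U b then 0 else edgeCost U F G e.1 e.2) = edgeCost U F G e.1 e.2 := by
    intro e _
    by_cases h : ∃ b, e.1 ∈ near U b
    · obtain ⟨b, hb⟩ := h
      rw [if_pos ⟨b, hb⟩, Finset.sum_eq_single b, if_pos hb, add_zero]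
      · exact fun c _ hc => if_neg fun hc' => hc (eq_of_mem_near hc' hb)
      · simp
    · rw [if_neg h, Finset.sum_eq_zero, zero_add]
      exact fun b _ => if_neg fun hb => h ⟨b, hb⟩
  calc _ ≤ ∑ b, (exitGap U G b x + ∑ e ∈ T, if e.1 ∈ near U b then edgeCost U F G e.1 e.2 else 0) +
        ∑ e ∈ T, (if ∃ b, e.1 ∈ near U b then 0 else edgeCost U F G e.1 e.2) := by
        gcongr with b
        exact exitCost_le_of_isRootedTree hG hT b
    _ = _ := by
        rw [Finset.sum_add_distrib, Finset.sum_comm, add_assoc, ← Finset.sum_add_distrib,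
          Finset.sum_congr rfl key]

theorem sum_exitGap_eq {a : ∀ i, A i} {x : State U} (hx : x ∈ near U a) :
    ∑ b, exitGap U G b x = exitGap U G a x := by
  refine Finset.sum_eq_single a (fun b _ hb => ?_) (by simp)
  have h : x ∉ near U b := fun h => hb (eq_of_mem_near h hx)
  have h' : x ≠ aligned U b := by rintro rfl; exact h (aligned_mem_near b)
  simp [exitGap, h, h']

/-- The total acceptance gap falls from the sum of `F (U i a)` at general discontent to 0 at the
root. Edges leaving the sets `near U b` never lower it, so the edges not charged for exits pay for
this fall. -/
theorem le_potential_aligned_add (hF : AntitoneOn F (Set.Icc 0 1))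
    (hF0 : ∀ u ∈ Set.Icc (0 : ℝ) 1, 0 ≤ F u) (hU : ∀ i a, U i a ∈ Set.Icc (0 : ℝ) 1)
    (hG : ∀ g a, g ∈ gainCosts U G a → g ≤ 1) (a : ∀ i, A i) :
    ∑ b, exitCost U G b + ∑ i, ENNReal.ofReal (F (U i a)) ≤
      potential (edgeCost U F G) (aligned U a) + exitCost U G a := by
  classical
  simp only [potential, ENNReal.iInf_add]
  refine le_iInf₂ fun T hT => ?_
  have h := sum_exitCost_add_le hG hT
  rw [sum_exitGap_eq (aligned_mem_near a), exitGap, if_pos rfl] at h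
  rw [add_comm _ (exitCost U G a)]
  refine le_trans ?_ h
  gcongr
  have h := hT.le_add_sum (fun s => ∑ i, acceptanceGap F (U i a) (s i))
    (fun e => if ∃ b, e.1 ∈ near U b then 0 else edgeCost U F G e.1 e.2) ?_
    (fun _ => .discontent)
  · simpa [acceptanceGap, aligned, observe] using h
  · rintro ⟨s, t⟩ he
    by_cases hs : ∃ b, s ∈ near U b
    · simp only [if_pos hs, add_zero]
      obtain ⟨b, hb⟩ := hs
      exact sum_acceptanceGap_le_of_mem_near hF hF0 hU _ hb (hT.edge _ he)
    · simp only [if_neg hs]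
      exact sum_acceptanceGap_le hF hF0 hU _ s t

/-- A root in `near U a` that is not aligned still leaves one unit of the exit from `aligned U a` to
be paid. A root outside all these sets saves nothing, and any `a` serves because exit costs are at
least 1. -/
theorem le_potential_add_of_not_aligned [∀ i, Nonempty (A i)]
    (hG : ∀ g a, g ∈ gainCosts U G a → g ≤ 1) {x : State U} (hx : ∀ a, x ≠ aligned U a) :
    ∃ a, ∑ b, exitCost U G b + 1 ≤ potential (edgeCost U F G) x + exitCost U G a := by
  classical
  obtain ⟨a, ha⟩ : ∃ a, ∑ b, exitGap U G b x + 1 ≤ exitCost U G a := by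
    by_cases h : ∃ a, x ∈ near U a
    · obtain ⟨a, ha⟩ := h
      refine ⟨a, ?_⟩
      rw [sum_exitGap_eq ha, exitGap, if_neg (hx a), if_pos ha,
        tsub_add_cancel_of_le (one_le_exitCost U G a)]
    · push Not at h
      refine ⟨fun i => Classical.arbitrary _, ?_⟩
      rw [Finset.sum_eq_zero fun b _ => by simp [exitGap, hx b, h b], zero_add]
      exact one_le_exitCost U G _
  refine ⟨a, ?_⟩
  simp only [potential, ENNReal.iInf_add]
  refine le_iInf₂ fun T hT => ?_
  calc ∑ b, exitCost U G b + 1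
      ≤ (∑ b, exitGap U G b x + ∑ e ∈ T, edgeCost U F G e.1 e.2) + 1 := by
        gcongr
        exact le_self_add.trans (sum_exitCost_add_le hG hT)
    _ = ∑ e ∈ T, edgeCost U F G e.1 e.2 + (∑ b, exitGap U G b x + 1) := by ring
    _ ≤ _ := by gcongr

end Bounds

/-! ### The states of minimum potential -/

section Minimizers

variable {I : Type*} {A : I → Type*} {U : I → (∀ j, A j) → ℝ}

theorem isAlignedAt_iff {x : State U} {a : ∀ i, A i} : IsAlignedAt U x a ↔ x = aligned U a :=
  funext_iff.symm

theorem aligned_injective : Function.Injective (aligned U) := fun a b h =>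
  eq_of_mem_near (aligned_mem_near a) (h ▸ aligned_mem_near b)

theorem mem_alignedStates_iff {x : State U} : x ∈ alignedStates U ↔ ∃ a, x = aligned U a :=
  exists_congr fun _ => isAlignedAt_iff

variable [DecidableEq I]

theorem mem_equilibriumStates_iff {x : State U} :
    x ∈ equilibriumStates U ↔ ∃ a, x = aligned U a ∧ IsNash U a :=
  exists_congr fun _ => and_congr_left' isAlignedAt_iff

theorem virtualStability_aligned (G : ℝ → ℝ → ℝ) (a : ∀ i, A i) :
    virtualStability U G (aligned U a) = 1 - sInf (gainCosts U G a) := by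
  unfold virtualStability
  congr 2
  ext g
  constructor
  · rintro ⟨a', ha', h⟩
    obtain rfl := aligned_injective (isAlignedAt_iff.1 ha')
    exact h
  · exact fun h => ⟨a, isAlignedAt_iff.2 rfl, h⟩

variable [Fintype I]

/-- The resistance of leaving an aligned state minus the resistance of reaching it from general
discontent. -/
noncomputable def score (U : I → (∀ j, A j) → ℝ) (F : ℝ → ℝ) (G : ℝ → ℝ → ℝ) (a : ∀ i, A i) : ℝ :=
  (exitCost U G a).toReal - ∑ i, F (U i a)

theorem score_of_isNash {F : ℝ → ℝ} {G : ℝ → ℝ → ℝ} {a : ∀ i, A i} (ha : IsNash U a) :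
    score U F G a = 1 + virtualWelfare U F (aligned U a) := by
  have : virtualWelfare U F (aligned U a) = 1 - ∑ i, F (U i a) := rfl
  rw [this, score, exitCost, if_pos ha, ENNReal.toReal_ofNat]
  ring

theorem score_of_not_isNash [∀ i, Finite (A i)] {F : ℝ → ℝ} {G : ℝ → ℝ → ℝ} {a : ∀ i, A i}
    (ha : ¬ IsNash U a) (hG : ∀ g ∈ gainCosts U G a, 0 ≤ g) :
    score U F G a =
      1 + (virtualWelfare U F (aligned U a) - virtualStability U G (aligned U a)) := by
  have : virtualWelfare U F (aligned U a) = 1 - ∑ i, F (U i a) := rfl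
  rw [this, score, exitCost, if_neg ha, virtualStability_aligned,
    ENNReal.toReal_add ENNReal.one_ne_top ENNReal.ofReal_ne_top,
    ENNReal.toReal_ofReal (hG _ (sInf_gainCosts_mem U G ha)), ENNReal.toReal_one]
  ring

variable [∀ i, Fintype (A i)] [∀ i, Nonempty (A i)]

theorem mem_minPotential_iff (hn : 2 ≤ Fintype.card I)
    (hU : ∀ i a, U i a ∈ Set.Icc (0 : ℝ) 1) {F : ℝ → ℝ} (hF : AntitoneOn F (Set.Icc 0 1))
    (hF0 : ∀ u ∈ Set.Icc (0 : ℝ) 1, 0 ≤ F u) (hF1 : ∀ a, ∑ i, F (U i a) < 1) {G : ℝ → ℝ → ℝ}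
    (hG : ∀ g a, g ∈ gainCosts U G a → g ≤ 1) (hinter : Interdependent U)
    (hopt : ∀ a, ∃ i, U i a < 1) {x : State U} :
    x ∈ minPotential (edgeCost U F G) ↔
      ∃ a, x = aligned U a ∧ ∀ b, score U F G b ≤ score U F G a := by
  have hsum : ∀ a, ∑ i, ENNReal.ofReal (F (U i a)) = ENNReal.ofReal (∑ i, F (U i a)) := fun a =>
    (ENNReal.ofReal_sum_of_nonneg fun i _ => hF0 _ (hU i a)).symm
  have hle := fun a => potential_aligned_add_le F G hinter hn (fun i a => (hU i a).2) hopt a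
  have heq : ∀ a, potential (edgeCost U F G) (aligned U a) + exitCost U G a =
      ∑ b, exitCost U G b + ENNReal.ofReal (∑ i, F (U i a)) := fun a => by
    rw [← hsum]
    exact le_antisymm (hle a) (le_potential_aligned_add hF hF0 hU hG a)
  have hK : ∑ b, exitCost U G b ≠ ∞ := ENNReal.sum_ne_top.2 fun b _ => exitCost_ne_top U G b
  have hfin : ∀ a, potential (edgeCost U F G) (aligned U a) ≠ ∞ := fun a h => by
    have := heq a
    rw [h, top_add] at this
    exact ENNReal.add_ne_top.2 ⟨hK, ENNReal.ofReal_ne_top⟩ this.symm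
  have hreal : ∀ a, (potential (edgeCost U F G) (aligned U a)).toReal =
      (∑ b, exitCost U G b).toReal - score U F G a := fun a => by
    have := congrArg ENNReal.toReal (heq a)
    rw [ENNReal.toReal_add (hfin a) (exitCost_ne_top U G a),
      ENNReal.toReal_add hK ENNReal.ofReal_ne_top,
      ENNReal.toReal_ofReal (Finset.sum_nonneg fun i _ => hF0 _ (hU i a))] at this
    rw [score]
    linarith
  have hcmp : ∀ a b, potential (edgeCost U F G) (aligned U a) ≤
      potential (edgeCost U F G) (aligned U b) ↔ score U F G b ≤ score U F G a := fun a b => by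
    rw [← ENNReal.toReal_le_toReal (hfin a) (hfin b), hreal, hreal, sub_le_sub_iff_left]
  have hnot : ∀ x, (∀ a, x ≠ aligned U a) →
      ∃ a, potential (edgeCost U F G) (aligned U a) < potential (edgeCost U F G) x := by
    intro x hx
    obtain ⟨a, ha⟩ := le_potential_add_of_not_aligned (F := F) hG hx
    refine ⟨a, (ENNReal.add_lt_add_iff_right (exitCost_ne_top U G a)).1 (lt_of_lt_of_le ?_ ha)⟩
    rw [heq]
    -- Acceptance costs less than the unit lost by a root that is not aligned.
    exact ENNReal.add_lt_add_left hK (ENNReal.ofReal_lt_one.2 (hF1 a))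
  constructor
  · intro hx
    by_cases h : ∃ a, x = aligned U a
    · obtain ⟨a, rfl⟩ := h
      exact ⟨a, rfl, fun b => (hcmp a b).1 (hx _)⟩
    · push Not at h
      obtain ⟨a, ha⟩ := hnot x h
      exact absurd (hx _) ha.not_ge
  · rintro ⟨a, rfl, ha⟩ y
    by_cases h : ∃ b, y = aligned U b
    · obtain ⟨b, rfl⟩ := h
      exact (hcmp a b).2 (ha b)
    · push Not at h
      obtain ⟨b, hb⟩ := hnot y h
      exact ((hcmp a b).2 (ha b)).trans hb.le

end Minimizers

end ITEL

theorem mainTheorem3 {I : Type*} [Fintype I] [DecidableEq I] (hn : 2 ≤ Fintype.card I)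
    {A : I → Type*} [∀ i, Fintype (A i)] [∀ i, Nonempty (A i)]
    (U : I → (∀ j, A j) → ℝ) (hU : ∀ i a, U i a ∈ Set.Icc (0 : ℝ) 1)
    (F : ℝ → ℝ) (hF : AntitoneOn F (Set.Icc 0 1))
    (G : ℝ → ℝ → ℝ)
    (hG_left : ∀ v v' u : ℝ, 0 ≤ v → v ≤ v' → v' < u → u ≤ 1 → G v u ≤ G v' u)
    (hG_right : ∀ v u u' : ℝ, 0 ≤ v → v < u → u ≤ u' → u' ≤ 1 → G v u' ≤ G v u)
    (cF : ℝ) (hcF : cF ∈ Set.Ioo (0 : ℝ) 1)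
    (hinter : ITEL.Interdependent U)
    (hbounds : ITEL.ResistanceBounds (Fintype.card I) F G)
    (hopt : ITEL.optimalStates U = ∅) :
    ((ITEL.equilibriumStates U).Nonempty →
      ITEL.minPotential (ITEL.edgeResistance U F G cF) =
        {x | x ∈ ITEL.equilibriumStates U ∧ ∀ y ∈ ITEL.equilibriumStates U,
          ITEL.virtualWelfare U F y ≤ ITEL.virtualWelfare U F x}) ∧
    (ITEL.equilibriumStates U = ∅ →
      ITEL.minPotential (ITEL.edgeResistance U F G cF) =
        {x | x ∈ ITEL.alignedStates U ∧ ∀ y ∈ ITEL.alignedStates U,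
          ITEL.virtualWelfare U F y - ITEL.virtualStability U G y ≤
            ITEL.virtualWelfare U F x - ITEL.virtualStability U G x}) := by
  obtain ⟨F₀, G₀, hFb, hGb, hFG⟩ := hbounds
  -- Strictness of the bound on `G` at the pair (0, 1) gives `G₀ > 0`, hence `F₀ < 1`, so total
  -- acceptance costs stay below 1.
  have hG₀ : 0 < G₀ := by
    obtain ⟨h1, h2⟩ := hGb 0 (by simp) 1 (by simp) one_pos
    exact h1.trans_lt h2
  have hsumF : ∀ a, ∑ i, F (U i a) ≤ F₀ := fun a => by
    have hn0 : (Fintype.card I : ℝ) ≠ 0 := by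
      have : Fintype.card I ≠ 0 := by omega
      exact_mod_cast this
    calc ∑ i, F (U i a) ≤ ∑ _i : I, F₀ / Fintype.card I :=
          Finset.sum_le_sum fun i _ => (hFb _ (hU i a)).2
      _ = F₀ := by
          rw [Finset.sum_const, Finset.card_univ, nsmul_eq_mul]
          field_simp
  have hsumF0 : ∀ a, 0 ≤ ∑ i, F (U i a) := fun a =>
    Finset.sum_nonneg fun i _ => (hFb _ (hU i a)).1
  have hgain : ∀ g a, g ∈ ITEL.gainCosts U G a → 0 ≤ g ∧ g < G₀ := by
    rintro _ a ⟨i, b, -, hlt, rfl⟩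
    exact hGb _ (hU i _) _ (hU i _) hlt
  have hopt' : ∀ a, ∃ i, U i a < 1 := fun a => by
    by_contra! h
    have : ITEL.aligned U a ∈ ITEL.optimalStates U :=
      ⟨a, fun _ => rfl, fun i => le_antisymm (hU i a).2 (h i)⟩
    rw [hopt] at this
    exact this
  have hedge : ITEL.edgeResistance U F G cF = ITEL.edgeCost U F G := by
    funext x y
    exact ITEL.edgeResistance_eq U hU hcF (fun u hu => (hFb u hu).1)
      (fun v hv u hu h => (hGb v hv u hu h).1) x y
  have hmin : ∀ x, x ∈ ITEL.minPotential (ITEL.edgeResistance U F G cF) ↔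
      ∃ a, x = ITEL.aligned U a ∧ ∀ b, ITEL.score U F G b ≤ ITEL.score U F G a := fun x => by
    rw [hedge]
    refine ITEL.mem_minPotential_iff hn hU hF (fun u hu => (hFb u hu).1)
      (fun a => ?_) (fun g a hg => ?_) hinter hopt'
    · linarith [hsumF a]
    · linarith [(hgain g a hg).2, hsumF a, hsumF0 a]
  constructor
  · rintro ⟨z, hz⟩
    obtain ⟨e, rfl, he⟩ := ITEL.mem_equilibriumStates_iff.1 hz
    -- An equilibrium scores at least `2 - F₀ ≥ 1 + G₀`. Any other profile scores at most 1 plus its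
    -- least gain cost, which is below `1 + G₀`.
    have hlt : ∀ a b, ITEL.IsNash U a → ¬ ITEL.IsNash U b →
        ITEL.score U F G b < ITEL.score U F G a := fun a b ha hb => by
      have h1 : ITEL.virtualWelfare U F (ITEL.aligned U a) = 1 - ∑ i, F (U i a) := rfl
      have h2 : ITEL.virtualWelfare U F (ITEL.aligned U b) = 1 - ∑ i, F (U i b) := rfl
      rw [ITEL.score_of_isNash ha, ITEL.score_of_not_isNash hb fun g hg => (hgain g b hg).1,
        ITEL.virtualStability_aligned, h1, h2]
      linarith [(hgain _ b (ITEL.sInf_gainCosts_mem U G hb)).2, hsumF a, hsumF0 b]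
    ext x
    refine (hmin x).trans ⟨?_, ?_⟩
    · rintro ⟨a, rfl, ha⟩
      have hNa : ITEL.IsNash U a := by
        by_contra h
        exact (ha e).not_gt (hlt e a he h)
      refine ⟨ITEL.mem_equilibriumStates_iff.2 ⟨a, rfl, hNa⟩, fun y hy => ?_⟩
      obtain ⟨b, rfl, hNb⟩ := ITEL.mem_equilibriumStates_iff.1 hy
      have := ha b
      rw [ITEL.score_of_isNash hNa, ITEL.score_of_isNash hNb] at this
      linarith
    · rintro ⟨hx, hmax⟩
      obtain ⟨a, rfl, hNa⟩ := ITEL.mem_equilibriumStates_iff.1 hx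
      refine ⟨a, rfl, fun b => ?_⟩
      by_cases hNb : ITEL.IsNash U b
      · have := hmax _ (ITEL.mem_equilibriumStates_iff.2 ⟨b, rfl, hNb⟩)
        rw [ITEL.score_of_isNash hNa, ITEL.score_of_isNash hNb]
        linarith
      · exact (hlt a b hNa hNb).le
  · intro hE
    have hN : ∀ a, ¬ ITEL.IsNash U a := fun a ha => by
      have := ITEL.mem_equilibriumStates_iff.2 ⟨a, rfl, ha⟩
      rw [hE] at this
      exact this
    have hscore := fun a => ITEL.score_of_not_isNash (F := F) (hN a) fun g hg => (hgain g a hg).1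
    ext x
    refine (hmin x).trans ⟨?_, ?_⟩
    · rintro ⟨a, rfl, ha⟩
      refine ⟨ITEL.mem_alignedStates_iff.2 ⟨a, rfl⟩, fun y hy => ?_⟩
      obtain ⟨b, rfl⟩ := ITEL.mem_alignedStates_iff.1 hy
      have := ha b
      rw [hscore, hscore] at this
      linarith
    · rintro ⟨hx, hmax⟩
      obtain ⟨a, rfl⟩ := ITEL.mem_alignedStates_iff.1 hx
      refine ⟨a, rfl, fun b => ?_⟩
      have := hmax _ (ITEL.mem_alignedStates_iff.2 ⟨b, rfl⟩)
      rw [hscore, hscore]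
      linarith
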